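/- Let $p$ be a prime, and let $q=p^k$ and $Q=p^\ell$ with $k,\ell\ge 1$. Let $a,b,c,d\in\mathbb{F}_{q^2}$ be not all zero. Let $\overline{\mathbb{F}}_q$ be an algebraic closure of $\mathbb{F}_{q^2}$, let $\mathbb{P}^1(\overline{\mathbb{F}}_q)=\overline{\mathbb{F}}_q\cup\{\infty\}$, and let $\mu_{q+1}=\{x\in\overline{\mathbb{F}}_q: x^{q+1}=1\}$. Put $$A(X)=aX^{Q+1}+bX^Q+cX+d,\qquad B(X)=d^qX^{Q+1}+c^qX^Q+b^qX+a^q,$$ and let $g(X)=B(X)/A(X)$. The rational function $g$ is always considered after cancelling common factors of its numerator and denominator: in this reduced form it defines a map $\mathbb{P}^1(\overline{\mathbb{F}}_q)\to\mathbb{P}^1(\overline{\mathbb{F}}_q)$, and $\deg(g)$ is the maximum of the degrees of its reduced numerator and denominator. If $g$ is nonconstant, its ramification multiset over a point $\beta$ is the multiset of the multiplicities of the distinct points of $g^{-1}(\beta)$ as $g$-preimages of $\beta$; if $g$ is constant, all its ramification multisets are empty. **(A)** At least one of the following holds: 1. $g(X)$ has ramification multiset $[1,Q]$ over some point of $\mathbb{P}^1(\overline{\mathbb{F}}_q)$;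 2. $g(X)=\rho\circ X^n\circ\sigma$ for some degree-one $\rho,\sigma\in\overline{\mathbb{F}}_q(X)$ and some $n\in\{Q-1,Q+1\}$; 3. $g(X)$ is constant; 4. $A(X)$ has at least one root in $\mu_{q+1}$. **(B)** If $q$ is even then the following are equivalent: 1. condition (A2) holds but (A4) does not hold; 2. $e:=a^{q+1}+b^{q+1}+c^{q+1}+d^{q+1}$ is nonzero, $(ab^q+cd^q)^Q=e^{Q-1}(ac^q+bd^q)$, and either $U(X)\nmid A(X)$ or $U(X)$ has no roots in $\mu_{q+1}$, where $U(X):=(ab^q+cd^q)X^2+eX+a^qb+c^qd$. **(C)** Suppose $q$ is even and (B2) holds. Let $W(X):=(bc+ad)X^2+eX+(bc+ad)^q$, and let $\Lambda\subseteq\mathbb{P}^1(\overline{\mathbb{F}}_q)$ be the set of roots of $W(X)$ in $\overline{\mathbb{F}}_q$, together with $\infty$ if $\deg(W)<2$. Then 1. each element of $\Lambda$ has a unique $g$-preimage in $\mathbb{P}^1(\overline{\mathbb{F}}_q)$; 2. each root of $U(X)$ in $\overline{\mathbb{F}}_q$ is the unique $g$-preimage of some element of $\Lambda$; 3. $\gcd(A(X),B(X))$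 divides $U(X)$; 4. $\deg(g)=Q-1$ if and only if $U(X)$ divides $A(X)$ and $b,c,d$ are not all zero. -/

import Mathlib

open Polynomial

noncomputable section

namespace QuadGeom

section RationalFunctions

variable {L : Type*} [Field L]

/-- The degree of a rational function: the maximum of the degrees of its numerator and
denominator in lowest terms. -/
def ratDeg (g : RatFunc L) : ℕ := max g.num.natDegree g.denom.natDegree

/-- The composition `f ∘ g` of rational functions, obtained by substituting `g` for the variable
of `f`. It is only used when `g` is nonconstant (so that no denominator vanishes). -/
def ratComp (f g : RatFunc L) : RatFunc L := f.eval RatFunc.C g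

/-- The map from the projective line to itself which is induced by a rational function (in lowest
terms). The projective line over `L` is `OnePoint L`, that is, `L` together with a point `∞`. -/
def evalP1 (g : RatFunc L) : OnePoint L → OnePoint L
  | OnePoint.some x =>
      open Classical in
      if g.denom.eval x = 0 then OnePoint.infty
      else OnePoint.some (g.num.eval x / g.denom.eval x)
  | OnePoint.infty =>
      if g.denom.natDegree < g.num.natDegree then OnePoint.infty
      else OnePoint.some (g.num.coeff g.denom.natDegree / g.denom.leadingCoeff)

/-- For `g = N / D` in lowest terms: the polynomial `N - β D` (for finite `β`) or `D`
(for `β = ∞`), whose roots are the finite `g`-preimages of `β`. -/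
def fibrePoly (g : RatFunc L) : OnePoint L → L[X]
  | OnePoint.some y => g.num - C y * g.denom
  | OnePoint.infty => g.denom

/-- The multiplicity of a point `α` of the projective line as a `g`-preimage of `β`:
for finite `α` this is the multiplicity of `α` as a root of the polynomial `fibrePoly g β`, and
for `α = ∞` it is the multiplicity of `∞` as a zero of the form of degree `deg g` obtained by
homogenizing that polynomial. -/
def preimageMult (g : RatFunc L) (β : OnePoint L) : OnePoint L → ℕ
  | OnePoint.some x => (fibrePoly g β).rootMultiplicity x
  | OnePoint.infty => ratDeg g - (fibrePoly g β).natDegree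

/-- The ramification index `e_g(α)`: the multiplicity of `α` as a `g`-preimage of `g(α)`. -/
def ramIdx (g : RatFunc L) (α : OnePoint L) : ℕ := preimageMult g (evalP1 g α) α

/-- The ramification multiset `E_g(β)`: the collection of all ramification indices `e_g(α)` with
`α` running through the `g`-preimages of `β`. It is empty if `g` is constant (and the set of
preimages is finite if `g` is nonconstant, so that the last case does not occur). -/
def ramMultiset (g : RatFunc L) (β : OnePoint L) : Multiset ℕ :=
  open Classical in
  if ratDeg g = 0 then 0
  else if h : (evalP1 g ⁻¹' {β}).Finite then h.toFinset.val.map (ramIdx g)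
  else 0

end RationalFunctions

section Quadrinomials

variable {K : Type*} [Field K]

/-- `A(X) = a X^{Q+1} + b X^Q + c X + d`. -/
def polyA (Q : ℕ) (a b c d : K) : K[X] :=
  C a * X ^ (Q + 1) + C b * X ^ Q + C c * X + C d

/-- `B(X) = d^q X^{Q+1} + c^q X^Q + b^q X + a^q`. -/
def polyB (q Q : ℕ) (a b c d : K) : K[X] :=
  C (d ^ q) * X ^ (Q + 1) + C (c ^ q) * X ^ Q + C (b ^ q) * X + C (a ^ q)

/-- `e = a^{q+1} + b^{q+1} + c^{q+1} + d^{q+1}`. -/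
def elemE (q : ℕ) (a b c d : K) : K :=
  a ^ (q + 1) + b ^ (q + 1) + c ^ (q + 1) + d ^ (q + 1)

/-- `U(X) = (a b^q + c d^q) X^2 + e X + (a^q b + c^q d)`. -/
def polyU (q : ℕ) (a b c d : K) : K[X] :=
  C (a * b ^ q + c * d ^ q) * X ^ 2 + C (elemE q a b c d) * X + C (a ^ q * b + c ^ q * d)

/-- `W(X) = (b c + a d) X^2 + e X + (b c + a d)^q`. -/
def polyW (q : ℕ) (a b c d : K) : K[X] :=
  C (b * c + a * d) * X ^ 2 + C (elemE q a b c d) * X + C ((b * c + a * d) ^ q)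

variable (L : Type*) [Field L] [Algebra K L]

/-- The rational function `g(X) = B(X) / A(X)`, over the extension field `L` of `K`. -/
def ratG (q Q : ℕ) (a b c d : K) : RatFunc L :=
  algebraMap L[X] (RatFunc L) ((polyB q Q a b c d).map (algebraMap K L)) /
    algebraMap L[X] (RatFunc L) ((polyA Q a b c d).map (algebraMap K L))

/-- `P` has at least one root in `L` which is an `n`-th root of unity. -/
def HasRootInMu (n : ℕ) (P : K[X]) : Prop :=
  ∃ x : L, x ^ n = 1 ∧ aeval x P = 0

/-- The set `Λ`: the roots of `W` in `L`, together with `∞` if `deg W < 2`. -/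
def setLambda (q : ℕ) (a b c d : K) : Set (OnePoint L) :=
  {β | (∃ x : L, aeval x (polyW q a b c d) = 0 ∧ β = OnePoint.some x) ∨
    ((polyW q a b c d).natDegree < 2 ∧ β = OnePoint.infty)}

/-- The coefficient criterion: `e ≠ 0`, `(a b^q + c d^q)^Q = e^{Q-1} (a c^q + b d^q)`, and either
`U` does not divide `A` or `U` has no roots in `μ_{q+1}`. -/
def CoeffCriterion (q Q : ℕ) (a b c d : K) : Prop :=
  elemE q a b c d ≠ 0 ∧
  (a * b ^ q + c * d ^ q) ^ Q = elemE q a b c d ^ (Q - 1) * (a * c ^ q + b * d ^ q) ∧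
  (¬ polyU q a b c d ∣ polyA Q a b c d ∨ ¬ HasRootInMu L (q + 1) (polyU q a b c d))

end Quadrinomials

/-- `g = ρ ∘ X^n ∘ σ` for some `ρ, σ` of degree one and some `n ∈ {Q - 1, Q + 1}`. -/
def IsLinearMonomialLinear {L : Type*} [Field L] (Q : ℕ) (g : RatFunc L) : Prop :=
  ∃ (n : ℕ) (ρ σ : RatFunc L), (n = Q - 1 ∨ n = Q + 1) ∧ ratDeg ρ = 1 ∧ ratDeg σ = 1 ∧
    g = ratComp ρ (ratComp (RatFunc.X ^ n) σ)

end QuadGeom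

end

/-! View aX^{Q+1}+bX^Q+cX+d as the 2×2 matrix with rows (a, b) and (c, d), paired with (X^Q, 1) and
(X, 1). As Q is a power of p, over an algebraically closed field such a form factors as l₁^Q l₂
exactly when ad − bc = 0. The members tB − sA of the pencil of A and B cut out the fibres of B/A,
and their determinant is a binary quadratic form in (s, t), so the pencil has a singular member.

For (A), suppose A and B have no common zero on the projective line. A singular member with l₁, l₂
independent is a fibre of type [1, Q]. Otherwise all singular members are (Q+1)-st powers, two
independent ones exist, and g is equivalent to X^{Q+1} (`pencil_dichotomy`). If there is a common
zero x ≠ 0, ∞, then x^{-q} is another one, because x ↦ x^{-q} exchanges the zeros of A and B. Unless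
x lies in μ_{q+1}, both forms are thus in the span of l₁^Q l₂ and l₂^Q l₁, and g is constant or
equivalent to X^{Q-1} (`exists_combination_of_common_zero`).

For (B) and (C), contracting A and B antisymmetrically in one of the two matrix indices gives two
quadratic covariants, which in characteristic 2 are U and a form V with leading coefficient ac^q +
bd^q, both with middle coefficient e; W is the determinant form. For the pencil of u^Q v and w^Q z,
U is proportional to vz, and V to uw with coefficients raised to the Q. Hence {u, w} = {v, z} up to
scalars amounts to e ≠ 0 and U^{(Q)} = e^{Q-1} V; the middle coefficients agree automatically and
the end ones are q-conjugate, which leaves one equation (`exists_isStandardPencil_of_criterion`,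
`IsStandardPencil.covariants`). In such a pencil Λ is the set of the two totally ramified values, U
is proportional to l₁ l₂, and the common factor of A and B is 1 or U up to scalars; (C) follows. -/

namespace QuadGeom

/-! ### Zeros of binary forms on the projective line -/

section ProjectiveLine

variable {L : Type*} [Field L]

/-- The point `[s : t]` of the projective line. -/
noncomputable def proj (s t : L) : OnePoint L :=
  open Classical in if t = 0 then OnePoint.infty else OnePoint.some (s / t)

lemma proj_of_eq_zero {s t : L} (ht : t = 0) : proj s t = OnePoint.infty := by
  simp [proj, ht]

lemma proj_of_ne_zero {s t : L} (ht : t ≠ 0) : proj s t = OnePoint.some (s / t) := by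
  simp [proj, ht]

lemma proj_eq_proj_iff {x y s t : L} (hxy : ¬ (x = 0 ∧ y = 0)) (hst : ¬ (s = 0 ∧ t = 0)) :
    proj x y = proj s t ↔ t * x - s * y = 0 := by
  by_cases hy : y = 0 <;> by_cases ht : t = 0
  · simp [proj_of_eq_zero, hy, ht]
  · have hx : x ≠ 0 := fun h => hxy ⟨h, hy⟩
    rw [proj_of_eq_zero hy, proj_of_ne_zero ht]
    simp [hy, ht, hx]
  · have hs : s ≠ 0 := fun h => hst ⟨h, ht⟩
    rw [proj_of_eq_zero ht, proj_of_ne_zero hy]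
    simp [hy, ht, hs]
  · rw [proj_of_ne_zero hy, proj_of_ne_zero ht, OnePoint.coe_eq_coe, div_eq_div_iff hy ht,
      sub_eq_zero, mul_comm x t]

lemma exists_eq_proj (β : OnePoint L) : ∃ s t : L, ¬ (s = 0 ∧ t = 0) ∧ β = proj s t := by
  induction β using OnePoint.rec with
  | infty => exact ⟨1, 0, by simp, by simp [proj]⟩
  | coe x => exact ⟨x, 1, by simp, by simp [proj]⟩

/-- The vanishing at a point of the projective line of the form of degree `m` which is obtained by
homogenizing `P`. -/
def VanishAt (m : ℕ) (P : L[X]) : OnePoint L → Prop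
  | OnePoint.some x => P.eval x = 0
  | OnePoint.infty => P.coeff m = 0

/-- The order of vanishing at a point of the projective line of the form of degree `m` which is
obtained by homogenizing `P`. -/
noncomputable def orderAt (m : ℕ) (P : L[X]) : OnePoint L → ℕ
  | OnePoint.some x => P.rootMultiplicity x
  | OnePoint.infty => m - P.natDegree

lemma vanishAt_coe {m : ℕ} {P : L[X]} {x : L} :
    VanishAt m P (OnePoint.some x) ↔ P.eval x = 0 := Iff.rfl

lemma vanishAt_infty {m : ℕ} {P : L[X]} : VanishAt m P OnePoint.infty ↔ P.coeff m = 0 := Iff.rfl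

lemma vanishAt_C_mul {m : ℕ} {P : L[X]} {κ : L} (hκ : κ ≠ 0) (α : OnePoint L) :
    VanishAt m (C κ * P) α ↔ VanishAt m P α := by
  induction α using OnePoint.rec with
  | infty => simp [vanishAt_infty, hκ]
  | coe x => simp [vanishAt_coe, hκ]

lemma vanishAt_mul {m n : ℕ} {P R : L[X]} (hP : P.natDegree ≤ m) (hR : R.natDegree ≤ n)
    (α : OnePoint L) :
    VanishAt (m + n) (P * R) α ↔ VanishAt m P α ∨ VanishAt n R α := by
  induction α using OnePoint.rec with
  | infty => simp [vanishAt_infty, coeff_mul_add_eq_of_natDegree_le hP hR]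
  | coe x => simp [vanishAt_coe]

lemma vanishAt_pow {m n : ℕ} {P : L[X]} (hP : P.natDegree ≤ m) (hn : n ≠ 0)
    (α : OnePoint L) : VanishAt (n * m) (P ^ n) α ↔ VanishAt m P α := by
  induction α using OnePoint.rec with
  | infty => simp [vanishAt_infty, coeff_pow_of_natDegree_le hP, hn]
  | coe x => simp [vanishAt_coe, hn]

lemma orderAt_C_mul {m : ℕ} {P : L[X]} {κ : L} (hκ : κ ≠ 0) (α : OnePoint L) :
    orderAt m (C κ * P) α = orderAt m P α := by
  by_cases hP : P = 0
  · simp [hP]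
  induction α using OnePoint.rec with
  | infty => simp [orderAt, natDegree_C_mul hκ]
  | coe x =>
    simp [orderAt, rootMultiplicity_mul (mul_ne_zero (C_ne_zero.2 hκ) hP)]

lemma orderAt_mul {m n : ℕ} {P R : L[X]} (hP : P.natDegree ≤ m) (hR : R.natDegree ≤ n)
    (hP0 : P ≠ 0) (hR0 : R ≠ 0) (α : OnePoint L) :
    orderAt (m + n) (P * R) α = orderAt m P α + orderAt n R α := by
  induction α using OnePoint.rec with
  | infty => simp only [orderAt, natDegree_mul hP0 hR0]; omega
  | coe x => simp [orderAt, rootMultiplicity_mul (mul_ne_zero hP0 hR0)]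

lemma orderAt_pow {m : ℕ} {P : L[X]} (hP : P.natDegree ≤ m) (hP0 : P ≠ 0) (n : ℕ)
    (α : OnePoint L) : orderAt (n * m) (P ^ n) α = n * orderAt m P α := by
  induction n with
  | zero =>
    induction α using OnePoint.rec with
    | infty => simp [orderAt]
    | coe x => simp [orderAt]
  | succ n ih =>
    rw [pow_succ, Nat.succ_mul, orderAt_mul (natDegree_pow_le_of_le n hP) hP
      (pow_ne_zero n hP0) hP0, ih, Nat.succ_mul]

end ProjectiveLine

/-! ### Fibres of a reduced fraction as zeros of pencil members -/

section Reduced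

variable {L : Type*} [Field L] {N D : L[X]}

/-- The denominator of a `RatFunc` is normalised to be monic, so a coprime pair is recovered only up
to a common scalar. -/
lemma exists_num_denom_eq (h : IsCoprime N D) (hD : D ≠ 0) :
    ∃ κ : L, κ ≠ 0 ∧
      (algebraMap L[X] (RatFunc L) N / algebraMap L[X] (RatFunc L) D).num = C κ * N ∧
      (algebraMap L[X] (RatFunc L) N / algebraMap L[X] (RatFunc L) D).denom = C κ * D := by
  set g := algebraMap L[X] (RatFunc L) N / algebraMap L[X] (RatFunc L) D with hg
  have hmul : g.num * D = N * g.denom := (RatFunc.num_mul_eq_mul_denom_iff hD).2 hg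
  have h1 : g.denom ∣ D := RatFunc.denom_div_dvd N D
  have h2 : D ∣ g.denom := h.symm.dvd_of_dvd_mul_left (hmul ▸ Dvd.intro_left _ rfl)
  obtain ⟨u, hu⟩ := associated_of_dvd_dvd h2 h1
  obtain ⟨κ, hκ, hκu⟩ := isUnit_iff.1 u.isUnit
  have hden : g.denom = C κ * D := by rw [← hu, ← hκu, mul_comm]
  refine ⟨κ, hκ.ne_zero, ?_, hden⟩
  apply mul_right_cancel₀ hD
  rw [hmul, hden]; ring

lemma ratDeg_eq (h : IsCoprime N D) (hD : D ≠ 0) :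
    ratDeg (algebraMap L[X] (RatFunc L) N / algebraMap L[X] (RatFunc L) D) =
      max N.natDegree D.natDegree := by
  obtain ⟨κ, hκ, h1, h2⟩ := exists_num_denom_eq h hD
  rw [ratDeg, h1, h2, natDegree_C_mul hκ, natDegree_C_mul hκ]

/-- Homogeneous coordinates remove the case distinctions at ∞, in the source and in the target: the
fibre over [s : t] is the zero set of one form. -/
lemma evalP1_eq_proj_iff (h : IsCoprime N D) (hD : D ≠ 0) {s t : L} (hst : ¬ (s = 0 ∧ t = 0))
    (α : OnePoint L) :
    evalP1 (algebraMap L[X] (RatFunc L) N / algebraMap L[X] (RatFunc L) D) α = proj s t ↔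
      VanishAt (max N.natDegree D.natDegree) (C t * N - C s * D) α := by
  obtain ⟨κ, hκ, h1, h2⟩ := exists_num_denom_eq h hD
  have key : ∀ x y : L, ¬ (x = 0 ∧ y = 0) →
      (proj (κ * x) (κ * y) = proj s t ↔ t * x - s * y = 0) := by
    intro x y hxy
    rw [proj_eq_proj_iff (by simpa [hκ] using hxy) hst,
      show t * (κ * x) - s * (κ * y) = κ * (t * x - s * y) by ring]
    simp [hκ]
  induction α using OnePoint.rec with
  | coe x =>
    have hx : ¬ (N.eval x = 0 ∧ D.eval x = 0) := by
      rintro ⟨hn, hd⟩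
      obtain ⟨u, v, huv⟩ := h
      simpa [hn, hd] using congrArg (eval x) huv
    have hev : evalP1 (algebraMap L[X] (RatFunc L) N / algebraMap L[X] (RatFunc L) D)
        (OnePoint.some x) = proj (κ * N.eval x) (κ * D.eval x) := by
      simp only [evalP1]
      rw [h1, h2]
      by_cases hx0 : D.eval x = 0
      · rw [if_pos (by simp [hx0]), proj_of_eq_zero (by simp [hx0])]
      · rw [if_neg (by simp [hx0, hκ]), proj_of_ne_zero (by simp [hx0, hκ])]
        simp
    rw [hev, key _ _ hx, vanishAt_coe]
    simp
  | infty =>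
    set m := max N.natDegree D.natDegree with hm
    have hx : ¬ (N.coeff m = 0 ∧ D.coeff m = 0) := by
      rintro ⟨hn, hd⟩
      rcases le_total N.natDegree D.natDegree with hle | hle
      · rw [hm, max_eq_right hle] at hd
        exact hD (leadingCoeff_eq_zero.1 hd)
      · rw [hm, max_eq_left hle] at hn hd
        have hN : N = 0 := leadingCoeff_eq_zero.1 hn
        have h0 : D.natDegree = N.natDegree := by rw [hN] at hle ⊢; simpa using hle
        rw [← h0] at hd
        exact hD (leadingCoeff_eq_zero.1 hd)
    have hev : evalP1 (algebraMap L[X] (RatFunc L) N / algebraMap L[X] (RatFunc L) D)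
        OnePoint.infty = proj (κ * N.coeff m) (κ * D.coeff m) := by
      simp only [evalP1, h1, h2, natDegree_C_mul hκ, coeff_C_mul, leadingCoeff_mul,
        leadingCoeff_C]
      split_ifs with hlt
      · rw [proj_of_eq_zero]
        rw [hm, max_eq_left hlt.le, coeff_eq_zero_of_natDegree_lt hlt, mul_zero]
      · rw [hm, max_eq_right (not_lt.1 hlt), proj_of_ne_zero]
        · rfl
        · exact mul_ne_zero hκ (leadingCoeff_ne_zero.2 hD)
    rw [hev, key _ _ hx, vanishAt_infty]
    simp

lemma preimageMult_proj (h : IsCoprime N D) (hD : D ≠ 0) {s t : L} (hst : ¬ (s = 0 ∧ t = 0))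
    (α : OnePoint L) :
    preimageMult (algebraMap L[X] (RatFunc L) N / algebraMap L[X] (RatFunc L) D) (proj s t) α =
      orderAt (max N.natDegree D.natDegree) (C t * N - C s * D) α := by
  obtain ⟨κ, hκ, h1, h2⟩ := exists_num_denom_eq h hD
  -- `fibrePoly` uses the affine coordinate s / t, or D alone at ∞; the scalar ν absorbs the change
  -- to homogeneous coordinates.
  obtain ⟨ν, hν, hf⟩ : ∃ ν : L, ν ≠ 0 ∧
      fibrePoly (algebraMap L[X] (RatFunc L) N / algebraMap L[X] (RatFunc L) D) (proj s t) =
        C ν * (C t * N - C s * D) := by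
    by_cases ht : t = 0
    · have hs : s ≠ 0 := fun h => hst ⟨h, ht⟩
      refine ⟨-(κ * s⁻¹), by simp [hκ, hs], ?_⟩
      rw [proj_of_eq_zero ht]
      change RatFunc.denom _ = _
      rw [h2, ht]
      have : C s⁻¹ * C s = (1 : L[X]) := by rw [← C_mul, inv_mul_cancel₀ hs, C_1]
      simp only [C_neg, C_mul, C_0]
      linear_combination -C κ * D * this
    · refine ⟨κ * t⁻¹, by simp [hκ, ht], ?_⟩
      rw [proj_of_ne_zero ht]
      change RatFunc.num _ - C _ * RatFunc.denom _ = _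
      rw [h1, h2]
      have : C t⁻¹ * C t = (1 : L[X]) := by rw [← C_mul, inv_mul_cancel₀ ht, C_1]
      simp only [div_eq_mul_inv, C_mul]
      linear_combination -C κ * N * this
  rw [← orderAt_C_mul hν, ← hf, ← ratDeg_eq h hD]
  induction α using OnePoint.rec with
  | infty => rfl
  | coe x => rfl

end Reduced

/-! ### Linear forms and fibres of type [1, Q] -/

section LinearForms

variable {L : Type*} [Field L]

/-- The linear form with coefficients `u` and `v`. -/
noncomputable def lin (u v : L) : L[X] := C u * X + C v

lemma natDegree_lin_le (u v : L) : (lin u v).natDegree ≤ 1 := natDegree_linear_le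

lemma coeff_lin_one (u v : L) : (lin u v).coeff 1 = u := by simp [lin]

lemma eval_lin (u v x : L) : (lin u v).eval x = u * x + v := by simp [lin]

lemma lin_ne_zero {u v : L} (h : ¬ (u = 0 ∧ v = 0)) : lin u v ≠ 0 := by
  intro h0
  refine h ⟨by simpa [lin] using congrArg (coeff · 1) h0, ?_⟩
  simpa [lin] using congrArg (coeff · 0) h0

lemma isCoprime_lin {v₀ v₁ w₀ w₁ : L} (h : v₀ * w₁ - v₁ * w₀ ≠ 0) :
    IsCoprime (lin v₀ v₁) (lin w₀ w₁) := by
  have hC : C (v₀ * w₁ - v₁ * w₀)⁻¹ * (C v₀ * C w₁ - C v₁ * C w₀) = (1 : L[X]) := by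
    rw [← C_mul, ← C_mul, ← C_sub, ← C_mul, inv_mul_cancel₀ h, C_1]
  refine ⟨-C (v₀ * w₁ - v₁ * w₀)⁻¹ * C w₀, C (v₀ * w₁ - v₁ * w₀)⁻¹ * C v₀, ?_⟩
  rw [← hC, lin, lin]; ring

lemma vanishAt_lin {u v : L} (h : ¬ (u = 0 ∧ v = 0)) (α : OnePoint L) :
    VanishAt 1 (lin u v) α ↔ α = proj (-v) u := by
  induction α using OnePoint.rec with
  | infty =>
    rw [vanishAt_infty, coeff_lin_one]
    by_cases hu : u = 0 <;> simp [proj, hu]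
  | coe x =>
    rw [vanishAt_coe, eval_lin]
    by_cases hu : u = 0
    · have hv : v ≠ 0 := fun hv => h ⟨hu, hv⟩
      rw [proj_of_eq_zero hu]
      simp [hu, hv]
    · rw [proj_of_ne_zero hu, OnePoint.coe_eq_coe, eq_div_iff hu, add_eq_zero_iff_eq_neg, mul_comm]

lemma orderAt_lin_self (u v : L) :
    orderAt 1 (lin u v) (proj (-v) u) = 1 := by
  by_cases hu : u = 0
  · rw [proj_of_eq_zero hu]
    simp [orderAt, lin, hu]
  · rw [proj_of_ne_zero hu]
    have : lin u v = C u * (X - C (-v / u)) := by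
      rw [lin, mul_sub, ← C_mul, mul_div_cancel₀ _ hu]; simp
    rw [this, orderAt_C_mul hu]
    simpa [orderAt] using rootMultiplicity_X_sub_C_pow (-v / u) 1

lemma orderAt_lin_of_ne {u v : L} (h : ¬ (u = 0 ∧ v = 0)) {α : OnePoint L}
    (hα : α ≠ proj (-v) u) : orderAt 1 (lin u v) α = 0 := by
  replace hα := mt (vanishAt_lin h α).1 hα
  induction α using OnePoint.rec with
  | infty =>
    rw [vanishAt_infty] at hα
    have := le_natDegree_of_ne_zero hα
    simp only [orderAt]; omega
  | coe x => exact rootMultiplicity_eq_zero hα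

lemma not_both_zero_left {v₀ v₁ w₀ w₁ : L} (h : v₀ * w₁ - v₁ * w₀ ≠ 0) :
    ¬ (v₀ = 0 ∧ v₁ = 0) := by
  rintro ⟨h1, h2⟩; simp [h1, h2] at h

lemma not_both_zero_right {v₀ v₁ w₀ w₁ : L} (h : v₀ * w₁ - v₁ * w₀ ≠ 0) :
    ¬ (w₀ = 0 ∧ w₁ = 0) := by
  rintro ⟨h1, h2⟩; simp [h1, h2] at h

/-- A fibre which is cut out by `l₁ ^ Q * l₂` with independent linear forms `l₁`, `l₂` has
ramification multiset `[1, Q]`. -/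
lemma ramMultiset_eq {N D : L[X]} (h : IsCoprime N D) (hD : D ≠ 0) {Q : ℕ} (hQ : Q ≠ 0)
    (hdeg : max N.natDegree D.natDegree = Q + 1) {s t : L} (hst : ¬ (s = 0 ∧ t = 0))
    {v₀ v₁ w₀ w₁ : L} (hvw : v₀ * w₁ - v₁ * w₀ ≠ 0)
    (hfib : C t * N - C s * D = lin v₀ v₁ ^ Q * lin w₀ w₁) :
    ramMultiset (algebraMap L[X] (RatFunc L) N / algebraMap L[X] (RatFunc L) D) (proj s t) =
      {1, Q} := by
  classical
  set g := algebraMap L[X] (RatFunc L) N / algebraMap L[X] (RatFunc L) D with hg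
  have hv := not_both_zero_left hvw
  have hw := not_both_zero_right hvw
  have hdegv : (lin v₀ v₁ ^ Q).natDegree ≤ Q * 1 := natDegree_pow_le_of_le Q (natDegree_lin_le _ _)
  have hdegw := natDegree_lin_le w₀ w₁
  have hmem : ∀ α, evalP1 g α = proj s t ↔ α = proj (-v₁) v₀ ∨ α = proj (-w₁) w₀ := by
    intro α
    rw [evalP1_eq_proj_iff h hD hst, hdeg, hfib, show Q + 1 = Q * 1 + 1 by ring,
      vanishAt_mul hdegv hdegw, vanishAt_pow (natDegree_lin_le _ _) hQ, vanishAt_lin hv,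
      vanishAt_lin hw]
  have hne : proj (-v₁) v₀ ≠ proj (-w₁) w₀ := by
    rw [Ne, proj_eq_proj_iff (by simpa [and_comm] using hv) (by simpa [and_comm] using hw)]
    intro h0
    exact hvw (by linear_combination h0)
  have hram : ∀ α, evalP1 g α = proj s t → ramIdx g α =
      Q * orderAt 1 (lin v₀ v₁) α + orderAt 1 (lin w₀ w₁) α := by
    intro α hα
    rw [ramIdx, hα, preimageMult_proj h hD hst, hdeg, hfib, show Q + 1 = Q * 1 + 1 by ring,
      orderAt_mul hdegv hdegw (pow_ne_zero _ (lin_ne_zero hv)) (lin_ne_zero hw),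
      orderAt_pow (natDegree_lin_le _ _) (lin_ne_zero hv)]
  have hset : evalP1 g ⁻¹' {proj s t} = {proj (-v₁) v₀, proj (-w₁) w₀} := by
    ext α; simpa using hmem α
  have hfin : (evalP1 g ⁻¹' {proj s t}).Finite := hset ▸ Set.toFinite _
  have hfs : hfin.toFinset = {proj (-v₁) v₀, proj (-w₁) w₀} := by
    ext α; simpa using hmem α
  have hg0 : ratDeg g ≠ 0 := by rw [hg, ratDeg_eq h hD, hdeg]; omega
  rw [ramMultiset, if_neg hg0, dif_pos hfin, hfs,
    Finset.insert_val_of_notMem (by simpa using hne)]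
  simp only [Finset.singleton_val, Multiset.map_cons, Multiset.map_singleton]
  rw [hram _ ((hmem _).2 (Or.inl rfl)), hram _ ((hmem _).2 (Or.inr rfl)),
    orderAt_lin_self, orderAt_lin_self, orderAt_lin_of_ne hw hne,
    orderAt_lin_of_ne hv hne.symm]
  simpa using Multiset.pair_comm Q 1

end LinearForms

/-! ### Rational functions equivalent to a monomial -/

section PowerPencil

variable {L : Type*} [Field L] {n : ℕ} {v₀ v₁ w₀ w₁ : L}

/-- The powers l₁ⁿ and l₂ⁿ are coprime, and an invertible linear change of the pair preserves the
ideal it generates. -/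
lemma isCoprime_power_pencil (hvw : v₀ * w₁ - v₁ * w₀ ≠ 0) {α₁ α₂ γ₁ γ₂ : L}
    (hΔ : α₁ * γ₂ - α₂ * γ₁ ≠ 0) :
    IsCoprime (C γ₁ * lin v₀ v₁ ^ n + C γ₂ * lin w₀ w₁ ^ n)
      (C α₁ * lin v₀ v₁ ^ n + C α₂ * lin w₀ w₁ ^ n) := by
  obtain ⟨x, y, hxy⟩ := (isCoprime_lin hvw).pow (m := n) (n := n)
  have hC : C (α₁ * γ₂ - α₂ * γ₁)⁻¹ * (C α₁ * C γ₂ - C α₂ * C γ₁) = (1 : L[X]) := by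
    rw [← C_mul, ← C_mul, ← C_sub, ← C_mul, inv_mul_cancel₀ hΔ, C_1]
  set i := C (α₁ * γ₂ - α₂ * γ₁)⁻¹
  refine ⟨i * (-x * C α₂ + y * C α₁), i * (x * C γ₂ - y * C γ₁), ?_⟩
  linear_combination hxy + (x * lin v₀ v₁ ^ n + y * lin w₀ w₁ ^ n) * hC

lemma natDegree_power_pencil_le (x y : L) :
    (C x * lin v₀ v₁ ^ n + C y * lin w₀ w₁ ^ n).natDegree ≤ n := by
  refine natDegree_add_le_of_degree_le ?_ ?_ <;>
  · refine (natDegree_C_mul_le _ _).trans ((natDegree_pow_le_of_le n (natDegree_lin_le _ _)).trans ?_)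
    rw [mul_one]

lemma coeff_power_pencil (x y : L) :
    (C x * lin v₀ v₁ ^ n + C y * lin w₀ w₁ ^ n).coeff n = x * v₀ ^ n + y * w₀ ^ n := by
  have key : ∀ u v : L, (lin u v ^ n).coeff n = u ^ n := by
    intro u v
    simpa [coeff_lin_one] using coeff_pow_of_natDegree_le (m := n) (natDegree_lin_le u v)
  simp [key]

lemma power_pencil_ne_zero (hvw : v₀ * w₁ - v₁ * w₀ ≠ 0) (hn : n ≠ 0) {x y : L}
    (hxy : ¬ (x = 0 ∧ y = 0)) : C x * lin v₀ v₁ ^ n + C y * lin w₀ w₁ ^ n ≠ 0 := by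
  intro h0
  have hcop := isCoprime_lin hvw
  have hv : ¬ (y ≠ 0 ∧ x = 0) := by
    rintro ⟨hy, hx⟩
    rw [hx, C_0, zero_mul, zero_add, mul_eq_zero, C_eq_zero] at h0
    exact h0.elim hy (pow_ne_zero _ (lin_ne_zero (not_both_zero_right hvw)))
  have hx : x ≠ 0 := by tauto
  have hx' : C x⁻¹ * C x = (1 : L[X]) := by rw [← C_mul, inv_mul_cancel₀ hx, C_1]
  have hdvd : lin w₀ w₁ ∣ lin v₀ v₁ ^ n := by
    refine (dvd_pow_self _ hn).trans ⟨-C x⁻¹ * C y, ?_⟩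
    linear_combination C x⁻¹ * h0 - lin v₀ v₁ ^ n * hx'
  have hunit : IsUnit (lin w₀ w₁) := (hcop.symm.pow_right (n := n)).isUnit_of_dvd' dvd_rfl hdvd
  obtain ⟨c, hc, hcw⟩ := isUnit_iff.1 hunit
  have hw0 : w₀ = 0 := by rw [← coeff_lin_one w₀ w₁, ← hcw]; simp
  have hv0 : v₀ ≠ 0 := by rintro rfl; simp [hw0] at hvw
  have := congrArg (coeff · n) h0
  simp only [coeff_power_pencil, hw0] at this
  simp [hn, hx, hv0] at this

/-- A drop of both degrees would be a common zero at ∞, hence one of l₁ⁿ and l₂ⁿ. -/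
lemma max_natDegree_power_pencil (hvw : v₀ * w₁ - v₁ * w₀ ≠ 0) (hn : n ≠ 0) {α₁ α₂ γ₁ γ₂ : L}
    (hΔ : α₁ * γ₂ - α₂ * γ₁ ≠ 0) :
    max (C γ₁ * lin v₀ v₁ ^ n + C γ₂ * lin w₀ w₁ ^ n).natDegree
      (C α₁ * lin v₀ v₁ ^ n + C α₂ * lin w₀ w₁ ^ n).natDegree = n := by
  refine le_antisymm (max_le (natDegree_power_pencil_le _ _) (natDegree_power_pencil_le _ _)) ?_
  by_contra! hlt
  rw [max_lt_iff] at hlt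
  have h1 := coeff_eq_zero_of_natDegree_lt hlt.1
  have h2 := coeff_eq_zero_of_natDegree_lt hlt.2
  rw [coeff_power_pencil] at h1 h2
  have hv : (α₁ * γ₂ - α₂ * γ₁) * v₀ ^ n = 0 := by linear_combination γ₂ * h2 - α₂ * h1
  have hw : (α₁ * γ₂ - α₂ * γ₁) * w₀ ^ n = 0 := by linear_combination α₁ * h1 - γ₁ * h2
  have hv0 : v₀ = 0 := by simpa [hΔ, hn] using hv
  have hw0 : w₀ = 0 := by simpa [hΔ, hn] using hw
  simp [hv0, hw0] at hvw

/-- The rational function `(γ₁ l₁ⁿ + γ₂ l₂ⁿ) / (α₁ l₁ⁿ + α₂ l₂ⁿ)` for linear forms `l₁`, `l₂`. -/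
noncomputable def powerRat (n : ℕ) (v₀ v₁ w₀ w₁ α₁ α₂ γ₁ γ₂ : L) : RatFunc L :=
  algebraMap L[X] (RatFunc L) (C γ₁ * lin v₀ v₁ ^ n + C γ₂ * lin w₀ w₁ ^ n) /
    algebraMap L[X] (RatFunc L) (C α₁ * lin v₀ v₁ ^ n + C α₂ * lin w₀ w₁ ^ n)

variable {α₁ α₂ γ₁ γ₂ : L}

lemma ratDeg_powerRat (hvw : v₀ * w₁ - v₁ * w₀ ≠ 0) (hn : n ≠ 0)
    (hΔ : α₁ * γ₂ - α₂ * γ₁ ≠ 0) : ratDeg (powerRat n v₀ v₁ w₀ w₁ α₁ α₂ γ₁ γ₂) = n := by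
  rw [powerRat, ratDeg_eq (isCoprime_power_pencil hvw hΔ)
    (power_pencil_ne_zero hvw hn (not_both_zero_left hΔ)), max_natDegree_power_pencil hvw hn hΔ]

lemma evalP1_powerRat_eq_proj_iff (hvw : v₀ * w₁ - v₁ * w₀ ≠ 0) (hn : n ≠ 0)
    (hΔ : α₁ * γ₂ - α₂ * γ₁ ≠ 0) {s t : L} (hst : ¬ (s = 0 ∧ t = 0)) (β : OnePoint L) :
    evalP1 (powerRat n v₀ v₁ w₀ w₁ α₁ α₂ γ₁ γ₂) β = proj s t ↔
      VanishAt n (C (t * γ₁ - s * α₁) * lin v₀ v₁ ^ n + C (t * γ₂ - s * α₂) * lin w₀ w₁ ^ n)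
        β := by
  rw [powerRat, evalP1_eq_proj_iff (isCoprime_power_pencil hvw hΔ)
    (power_pencil_ne_zero hvw hn (not_both_zero_left hΔ)) hst,
    max_natDegree_power_pencil hvw hn hΔ]
  congr! 1
  simp only [C_sub, C_mul]; ring

/-- Total ramification: the hypothesis `h` kills the l₂ⁿ term of the member over [s : t] and leaves
a multiple of l₁ⁿ. The other such value follows by `powerRat_swap`. -/
lemma evalP1_powerRat_eq_iff_left (hvw : v₀ * w₁ - v₁ * w₀ ≠ 0) (hn : n ≠ 0)
    (hΔ : α₁ * γ₂ - α₂ * γ₁ ≠ 0) {s t : L} (hst : ¬ (s = 0 ∧ t = 0))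
    (h : t * γ₂ - s * α₂ = 0) (β : OnePoint L) :
    evalP1 (powerRat n v₀ v₁ w₀ w₁ α₁ α₂ γ₁ γ₂) β = proj s t ↔ β = proj (-v₁) v₀ := by
  have h' : t * γ₁ - s * α₁ ≠ 0 := by
    intro h'
    refine hst ⟨(mul_eq_zero.1 (?_ : s * (α₁ * γ₂ - α₂ * γ₁) = 0)).resolve_right hΔ,
      (mul_eq_zero.1 (?_ : t * (α₁ * γ₂ - α₂ * γ₁) = 0)).resolve_right hΔ⟩
    · linear_combination γ₁ * h - γ₂ * h'
    · linear_combination α₁ * h - α₂ * h'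
  rw [evalP1_powerRat_eq_proj_iff hvw hn hΔ hst, h, C_0, zero_mul, add_zero, vanishAt_C_mul h',
    ← vanishAt_lin (not_both_zero_left hvw)]
  conv_lhs => rw [← mul_one n]
  rw [mul_one n, ← vanishAt_pow (natDegree_lin_le v₀ v₁) hn, mul_one]

lemma powerRat_swap (n : ℕ) (v₀ v₁ w₀ w₁ α₁ α₂ γ₁ γ₂ : L) :
    powerRat n v₀ v₁ w₀ w₁ α₁ α₂ γ₁ γ₂ = powerRat n w₀ w₁ v₀ v₁ α₂ α₁ γ₂ γ₁ := by
  simp only [powerRat, add_comm]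

lemma eval₂_lin (x y : L) (s : RatFunc L) :
    (lin x y).eval₂ RatFunc.C s = RatFunc.C x * s + RatFunc.C y := by
  simp [lin]

/-- Divide numerator and denominator by l₂ⁿ: then σ = l₁ / l₂ and ρ is the Möbius map with the
coefficients γ over α. -/
lemma isLinearMonomialLinear_powerRat (hvw : v₀ * w₁ - v₁ * w₀ ≠ 0)
    (hΔ : α₁ * γ₂ - α₂ * γ₁ ≠ 0) {Q : ℕ} (hQ : n = Q - 1 ∨ n = Q + 1) :
    IsLinearMonomialLinear Q (powerRat n v₀ v₁ w₀ w₁ α₁ α₂ γ₁ γ₂) := by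
  have key : ∀ {a b c d : L}, a * d - b * c ≠ 0 →
      ratDeg (algebraMap L[X] (RatFunc L) (lin c d) / algebraMap L[X] (RatFunc L) (lin a b)) = 1 ∧
      ∃ κ : L, κ ≠ 0 ∧
        (algebraMap L[X] (RatFunc L) (lin c d) / algebraMap L[X] (RatFunc L) (lin a b)).num =
          C κ * lin c d ∧
        (algebraMap L[X] (RatFunc L) (lin c d) / algebraMap L[X] (RatFunc L) (lin a b)).denom =
          C κ * lin a b := by
    intro a b c d h
    have hc := (isCoprime_lin h).symm
    have h0 := lin_ne_zero (not_both_zero_left h)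
    refine ⟨?_, exists_num_denom_eq hc h0⟩
    rw [ratDeg_eq hc h0]
    refine le_antisymm (max_le (natDegree_lin_le _ _) (natDegree_lin_le _ _)) ?_
    by_contra! hlt
    rw [max_lt_iff] at hlt
    have h1 := coeff_eq_zero_of_natDegree_lt hlt.1
    have h2 := coeff_eq_zero_of_natDegree_lt hlt.2
    rw [coeff_lin_one] at h1 h2
    simp [h1, h2] at h
  have hwv : w₀ * v₁ - w₁ * v₀ ≠ 0 := fun h => hvw (by linear_combination -h)
  obtain ⟨hσ, -⟩ := key hwv
  obtain ⟨hρ, κ, hκ, hnum, hden⟩ := key hΔ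
  refine ⟨n, algebraMap L[X] (RatFunc L) (lin γ₁ γ₂) / algebraMap L[X] (RatFunc L) (lin α₁ α₂),
    algebraMap L[X] (RatFunc L) (lin v₀ v₁) / algebraMap L[X] (RatFunc L) (lin w₀ w₁), hQ, hρ, hσ,
    ?_⟩
  have hX : ∀ s : RatFunc L, ratComp (RatFunc.X ^ n) s = s ^ n := by
    intro s
    have : (RatFunc.X ^ n : RatFunc L) = algebraMap L[X] (RatFunc L) (X ^ n) := by simp
    rw [ratComp, this, RatFunc.eval_algebraMap]
    simp
  rw [hX, ratComp, RatFunc.eval, hnum, hden]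
  simp only [eval₂_mul, eval₂_C]
  have hκ' : RatFunc.C κ ≠ 0 := by simpa using hκ
  rw [mul_div_mul_left _ _ hκ', eval₂_lin, eval₂_lin, powerRat]
  have hw : algebraMap L[X] (RatFunc L) (lin w₀ w₁) ≠ 0 := by
    simpa using lin_ne_zero (not_both_zero_right hvw)
  have hwn := pow_ne_zero n hw
  symm
  rw [← mul_div_mul_right _ _ hwn]
  simp only [map_add, map_mul, map_pow, RatFunc.algebraMap_C, div_pow, add_mul, mul_assoc]
  rw [div_mul_cancel₀ _ hwn]

lemma exists_eq_powerRat_of_isLinearMonomialLinear {Q : ℕ} {g : RatFunc L}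
    (h : IsLinearMonomialLinear Q g) :
    ∃ (n : ℕ) (v₀ v₁ w₀ w₁ α₁ α₂ γ₁ γ₂ : L), (n = Q - 1 ∨ n = Q + 1) ∧
      v₀ * w₁ - v₁ * w₀ ≠ 0 ∧ α₁ * γ₂ - α₂ * γ₁ ≠ 0 ∧
      g = powerRat n v₀ v₁ w₀ w₁ α₁ α₂ γ₁ γ₂ := by
  obtain ⟨n, ρ, σ, hn, hρ, hσ, rfl⟩ := h
  have key : ∀ τ : RatFunc L, ratDeg τ = 1 → ∃ a b c d : L, a * d - b * c ≠ 0 ∧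
      τ.num = lin c d ∧ τ.denom = lin a b := by
    intro τ hτ
    have hN : τ.num.natDegree ≤ 1 := hτ ▸ le_max_left _ _
    have hD : τ.denom.natDegree ≤ 1 := hτ ▸ le_max_right _ _
    obtain ⟨c, d, hcd⟩ := exists_eq_X_add_C_of_natDegree_le_one hN
    obtain ⟨a, b, hab⟩ := exists_eq_X_add_C_of_natDegree_le_one hD
    -- A zero determinant makes numerator and denominator proportional; being coprime, they would
    -- both be constant, against degree one.
    refine ⟨a, b, c, d, fun h0 => ?_, hcd, hab⟩
    have hcop := τ.isCoprime_num_denom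
    have hnd : ¬ (a = 0 ∧ c = 0) := by
      rintro ⟨rfl, rfl⟩
      rw [ratDeg, hcd, hab] at hτ
      simp at hτ
    have h1 : C a * τ.num = C c * τ.denom := by
      rw [hcd, hab]
      have := congrArg C h0
      simp only [C_sub, C_mul, C_0] at this
      linear_combination this
    have hdvd : τ.denom ∣ C a := hcop.symm.dvd_of_dvd_mul_right ⟨C c, by rw [h1, mul_comm]⟩
    have hdvd' : τ.num ∣ C c := hcop.dvd_of_dvd_mul_right ⟨C a, by rw [← h1, mul_comm]⟩
    have ha : a = 0 := by
      by_contra ha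
      have h2 : τ.denom.natDegree = 0 :=
        Nat.le_zero.1 ((natDegree_le_of_dvd hdvd (C_ne_zero.2 ha)).trans (by simp))
      rw [hab, natDegree_linear ha] at h2
      exact one_ne_zero h2
    have hc : c = 0 := by
      by_contra hc
      have h2 : τ.num.natDegree = 0 :=
        Nat.le_zero.1 ((natDegree_le_of_dvd hdvd' (C_ne_zero.2 hc)).trans (by simp))
      rw [hcd, natDegree_linear hc] at h2
      exact one_ne_zero h2
    exact hnd ⟨ha, hc⟩
  obtain ⟨α₁, α₂, γ₁, γ₂, hΔ, hρn, hρd⟩ := key ρ hρ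
  obtain ⟨w₀, w₁, v₀, v₁, hwv, hσn, hσd⟩ := key σ hσ
  have hvw : v₀ * w₁ - v₁ * w₀ ≠ 0 := fun h => hwv (by linear_combination -h)
  refine ⟨n, v₀, v₁, w₀, w₁, α₁, α₂, γ₁, γ₂, hn, hvw, hΔ, ?_⟩
  have hX : ratComp (RatFunc.X ^ n) σ = σ ^ n := by
    have : (RatFunc.X ^ n : RatFunc L) = algebraMap L[X] (RatFunc L) (X ^ n) := by simp
    rw [ratComp, this, RatFunc.eval_algebraMap]
    simp
  have hσ' := σ.num_div_denom
  rw [hσn, hσd] at hσ'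
  rw [hX, ratComp, RatFunc.eval, hρn, hρd, eval₂_lin, eval₂_lin, powerRat, ← hσ']
  have hw : algebraMap L[X] (RatFunc L) (lin w₀ w₁) ≠ 0 := by
    simpa using lin_ne_zero (not_both_zero_right hvw)
  have hwn := pow_ne_zero n hw
  rw [← mul_div_mul_right _ _ hwn]
  simp only [map_add, map_mul, map_pow, RatFunc.algebraMap_C, div_pow, add_mul, mul_assoc]
  rw [div_mul_cancel₀ _ hwn]

end PowerPencil

/-! ### Forms as 2×2 matrices, and roots of binary quadratic forms -/

section Pencils

variable {L : Type*} [Field L] {Q : ℕ}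

/-- `A` and `B` are the linear combinations with coefficients `α₁, α₂` and `γ₁, γ₂` of the
`(Q + 1)`-st powers of two independent linear forms, and these combinations are independent. -/
structure IsPowerPencil (Q : ℕ) (A B : L[X]) (v₀ v₁ w₀ w₁ α₁ α₂ γ₁ γ₂ : L) : Prop where
  forms : v₀ * w₁ - v₁ * w₀ ≠ 0
  coeffs : α₁ * γ₂ - α₂ * γ₁ ≠ 0
  left : A = C α₁ * (lin v₀ v₁ ^ Q * lin v₀ v₁) + C α₂ * (lin w₀ w₁ ^ Q * lin w₀ w₁)
  right : B = C γ₁ * (lin v₀ v₁ ^ Q * lin v₀ v₁) + C γ₂ * (lin w₀ w₁ ^ Q * lin w₀ w₁)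

/-- `A` and `B` are the linear combinations with coefficients `α₁, α₂` and `γ₁, γ₂` of
`l₁ ^ Q * l₂` and `l₂ ^ Q * l₁` for two independent linear forms `l₁`, `l₂`, and these
combinations are independent. -/
structure IsTwistedPencil (Q : ℕ) (A B : L[X]) (v₀ v₁ w₀ w₁ α₁ α₂ γ₁ γ₂ : L) : Prop where
  forms : v₀ * w₁ - v₁ * w₀ ≠ 0
  coeffs : α₁ * γ₂ - α₂ * γ₁ ≠ 0
  left : A = C α₁ * (lin v₀ v₁ ^ Q * lin w₀ w₁) + C α₂ * (lin w₀ w₁ ^ Q * lin v₀ v₁)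
  right : B = C γ₁ * (lin v₀ v₁ ^ Q * lin w₀ w₁) + C γ₂ * (lin w₀ w₁ ^ Q * lin v₀ v₁)

lemma polyA_combination (x y a b c d a' b' c' d' : L) :
    C x * polyA Q a b c d + C y * polyA Q a' b' c' d' =
      polyA Q (x * a + y * a') (x * b + y * b') (x * c + y * c') (x * d + y * d') := by
  simp only [polyA, C_add, C_mul]; ring

lemma polyA_sub (s t a b c d a' b' c' d' : L) :
    C t * polyA Q a' b' c' d' - C s * polyA Q a b c d =
      polyA Q (t * a' - s * a) (t * b' - s * b) (t * c' - s * c) (t * d' - s * d) := by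
  simp only [polyA, C_sub, C_mul]; ring

lemma C_mul_polyA (x a b c d : L) :
    C x * polyA Q a b c d = polyA Q (x * a) (x * b) (x * c) (x * d) := by
  simp only [polyA, C_mul]; ring

/-- For Q ≥ 2 the exponents 0, 1, Q, Q + 1 are distinct, so the form determines its matrix. -/
lemma polyA_inj (hQ : 2 ≤ Q) {a b c d a' b' c' d' : L}
    (h : polyA Q a b c d = polyA Q a' b' c' d') : a = a' ∧ b = b' ∧ c = c' ∧ d = d' := by
  have hc : ∀ n, (polyA Q a b c d).coeff n = (polyA Q a' b' c' d').coeff n := fun n => by rw [h]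
  simp only [polyA, coeff_add, coeff_C_mul, coeff_X_pow, coeff_X, coeff_C] at hc
  have h0 := hc 0
  have h1 := hc 1
  have h2 := hc Q
  have h3 := hc (Q + 1)
  have e1 : ¬ 0 = Q := by omega
  have e2 : ¬ 1 = Q := by omega
  have e3 : ¬ Q = 0 := by omega
  simp [e1, e2, e3] at h0 h1 h2 h3
  exact ⟨h3, h2, h1, h0⟩

lemma natDegree_polyA_le (a b c d : L) : (polyA Q a b c d).natDegree ≤ Q + 1 := by
  rw [polyA]
  compute_degree

lemma coeff_polyA (hQ : 2 ≤ Q) (a b c d : L) : (polyA Q a b c d).coeff (Q + 1) = a := by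
  have e1 : ¬ Q = 0 := by omega
  simp [polyA, coeff_C, coeff_X_pow, e1]

lemma eval_polyA (a b c d x : L) :
    (polyA Q a b c d).eval x = a * x ^ (Q + 1) + b * x ^ Q + c * x + d := by
  simp [polyA]

lemma exists_mul_eq_of_det_eq_zero {u₀ u₁ v₀ v₁ : L} (hu : ¬ (u₀ = 0 ∧ u₁ = 0))
    (h : u₀ * v₁ - u₁ * v₀ = 0) : ∃ κ, v₀ = κ * u₀ ∧ v₁ = κ * u₁ := by
  by_cases h0 : u₀ = 0
  · have h1 : u₁ ≠ 0 := fun h1 => hu ⟨h0, h1⟩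
    have hv : v₀ = 0 := by simpa [h0, h1] using h
    exact ⟨v₁ / u₁, by simp [h0, hv], by field_simp⟩
  · refine ⟨v₀ / u₀, by field_simp, ?_⟩
    field_simp
    linear_combination h

variable [IsAlgClosed L]

lemma exists_root_binary_quadratic (x y z : L) :
    ∃ s t : L, ¬ (s = 0 ∧ t = 0) ∧ x * s ^ 2 + y * s * t + z * t ^ 2 = 0 := by
  by_cases hx : x = 0
  · exact ⟨1, 0, by simp, by simp [hx]⟩
  · obtain ⟨s, hs⟩ := IsAlgClosed.exists_root (C x * X ^ 2 + C y * X + C z)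
      (by rw [degree_quadratic hx]; decide)
    refine ⟨s, 1, by simp, ?_⟩
    simpa [IsRoot] using hs

lemma exists_independent_roots_binary_quadratic [CharP L 2] {x y z : L} (hy : y ≠ 0) :
    ∃ s t s' t' : L, s * t' - s' * t ≠ 0 ∧ x * s ^ 2 + y * s * t + z * t ^ 2 = 0 ∧
      x * s' ^ 2 + y * s' * t' + z * t' ^ 2 = 0 := by
  have h2 : (2 : L) = 0 := CharTwo.two_eq_zero
  by_cases hx : x = 0
  · refine ⟨1, 0, z, -y, by simpa using hy, by simp [hx], by rw [hx]; ring⟩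
  · obtain ⟨s, t, hst, h⟩ := exists_root_binary_quadratic x y z
    have ht : t ≠ 0 := by
      rintro rfl
      exact hst ⟨by simpa [hx] using h, rfl⟩
    -- In characteristic 2 the roots sum to y / x, so the second one is s / t + y / x; it is
    -- different because y ≠ 0.
    refine ⟨s, t, x * s + y * t, x * t, ?_, h, ?_⟩
    · rw [show s * (x * t) - (x * s + y * t) * t = -(y * t ^ 2) by ring]
      simp [hy, ht]
    · linear_combination x ^ 2 * h + (x * y * s * x * t + y ^ 2 * t ^ 2 * x) * h2

/-- A singular matrix is a column times a row; algebraic closedness allows the column entries to be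
Q-th powers. -/
lemma exists_rank_one (hQ : Q ≠ 0) {a b c d : L} (h : a * d - b * c = 0) :
    ∃ u₀ u₁ v₀ v₁ : L,
      a = u₀ ^ Q * v₀ ∧ b = u₀ ^ Q * v₁ ∧ c = u₁ ^ Q * v₀ ∧ d = u₁ ^ Q * v₁ := by
  by_cases hab : a = 0 ∧ b = 0
  · exact ⟨0, 1, c, d, by simp [hQ, hab.1], by simp [hQ, hab.2], by simp, by simp⟩
  · obtain ⟨κ, hc, hd⟩ := exists_mul_eq_of_det_eq_zero hab h
    obtain ⟨u, hu⟩ := IsAlgClosed.exists_pow_nat_eq κ (Nat.pos_of_ne_zero hQ)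
    exact ⟨1, u, a, b, by simp, by simp, by rw [hu, hc], by rw [hu, hd]⟩

lemma exists_vanishAt_polyA (hQ : 2 ≤ Q) (a b c d : L) :
    ∃ α, VanishAt (Q + 1) (polyA Q a b c d) α := by
  by_cases ha : a = 0
  · exact ⟨OnePoint.infty, by rw [vanishAt_infty, coeff_polyA hQ, ha]⟩
  · have hdeg : (polyA Q a b c d).degree ≠ 0 := by
      intro h0
      have h1 := natDegree_eq_zero_iff_degree_le_zero.2 h0.le
      have h2 : Q + 1 ≤ (polyA Q a b c d).natDegree :=
        le_natDegree_of_ne_zero (by rwa [coeff_polyA hQ])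
      omega
    obtain ⟨x, hx⟩ := IsAlgClosed.exists_root _ hdeg
    exact ⟨OnePoint.some x, hx⟩

omit [IsAlgClosed L] in
lemma vanishAt_of_sub {m : ℕ} {A B : L[X]} {s t s' t' : L} (h : s * t' - s' * t ≠ 0)
    {α : OnePoint L} (h1 : VanishAt m (C t * B - C s * A) α)
    (h2 : VanishAt m (C t' * B - C s' * A) α) : VanishAt m A α ∧ VanishAt m B α := by
  induction α using OnePoint.rec with
  | infty =>
    simp only [vanishAt_infty, coeff_sub, coeff_C_mul] at h1 h2 ⊢
    exact ⟨(mul_eq_zero.1 (by linear_combination t * h2 - t' * h1 :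
      (s * t' - s' * t) * A.coeff m = 0)).resolve_left h,
      (mul_eq_zero.1 (by linear_combination s * h2 - s' * h1 :
      (s * t' - s' * t) * B.coeff m = 0)).resolve_left h⟩
  | coe x =>
    simp only [vanishAt_coe, eval_sub, eval_mul, eval_C] at h1 h2 ⊢
    exact ⟨(mul_eq_zero.1 (by linear_combination t * h2 - t' * h1 :
      (s * t' - s' * t) * A.eval x = 0)).resolve_left h,
      (mul_eq_zero.1 (by linear_combination s * h2 - s' * h1 :
      (s * t' - s' * t) * B.eval x = 0)).resolve_left h⟩

end Pencils

/-! ### Singular members of a pencil -/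

section Frobenius

variable {L : Type*} [Field L] {p l Q : ℕ} [Fact p.Prime] [CharP L p]

lemma lin_pow (hQ : Q = p ^ l) (u v : L) : lin u v ^ Q = C (u ^ Q) * X ^ Q + C (v ^ Q) := by
  subst hQ
  rw [lin, add_pow_char_pow, mul_pow, ← C_pow, ← C_pow]

lemma lin_pow_mul_lin (hQ : Q = p ^ l) (u₀ u₁ v₀ v₁ : L) :
    lin u₀ u₁ ^ Q * lin v₀ v₁ =
      polyA Q (u₀ ^ Q * v₀) (u₀ ^ Q * v₁) (u₁ ^ Q * v₀) (u₁ ^ Q * v₁) := by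
  rw [lin_pow hQ, lin, polyA]
  simp only [C_mul]; ring

lemma vanishAt_polyA_proj (hQ : Q = p ^ l) (hQ2 : 2 ≤ Q) {u₀ u₁ : L} (hu : ¬ (u₀ = 0 ∧ u₁ = 0))
    (a b c d : L) :
    VanishAt (Q + 1) (polyA Q a b c d) (proj (-u₁) u₀) ↔
      a * (u₁ ^ Q * u₁) - b * (u₁ ^ Q * u₀) - c * (u₀ ^ Q * u₁) + d * (u₀ ^ Q * u₀) = 0 := by
  by_cases h0 : u₀ = 0
  · have h1 : u₁ ≠ 0 := fun h1 => hu ⟨h0, h1⟩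
    have hQ0 : Q ≠ 0 := by omega
    rw [proj_of_eq_zero h0, vanishAt_infty, coeff_polyA hQ2, h0]
    simp [hQ0, h1]
  · rw [proj_of_ne_zero h0, vanishAt_coe, eval_polyA]
    set x := -u₁ / u₀ with hx
    have hx1 : u₁ = -(x * u₀) := by rw [hx]; field_simp
    -- Additivity of Frobenius gives the sign (−1)^Q = −1 without a case split on the parity of p.
    have hx2 : u₁ ^ Q = -(x ^ Q * u₀ ^ Q) := by
      have h3 : (lin u₀ u₁ ^ Q).eval x = 0 := by
        rw [eval_pow, eval_lin, hx1]
        have hQ0 : Q ≠ 0 := by omega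
        rw [show u₀ * x + -(x * u₀) = 0 by ring, zero_pow hQ0]
      rw [lin_pow hQ] at h3
      simp only [eval_add, eval_mul, eval_C, eval_pow, eval_X] at h3
      linear_combination h3
    have key : a * (u₁ ^ Q * u₁) - b * (u₁ ^ Q * u₀) - c * (u₀ ^ Q * u₁) + d * (u₀ ^ Q * u₀) =
        u₀ ^ Q * u₀ * (a * x ^ (Q + 1) + b * x ^ Q + c * x + d) := by
      rw [hx2, pow_succ x Q]
      linear_combination (-(a * x ^ Q * u₀ ^ Q) - c * u₀ ^ Q) * hx1
    rw [key]
    simp [h0]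

lemma det_pow (hQ : Q = p ^ l) (u₀ u₁ w₀ w₁ : L) :
    (u₀ * w₁ - u₁ * w₀) ^ Q = u₀ ^ Q * w₁ ^ Q - u₁ ^ Q * w₀ ^ Q := by
  subst hQ
  rw [sub_pow_char_pow, mul_pow, mul_pow]

lemma coeffs_of_eq_combination (hQ : Q = p ^ l) (hQ2 : 2 ≤ Q)
    {a b c d x y u₀ u₁ v₀ v₁ w₀ w₁ z₀ z₁ : L}
    (h : polyA Q a b c d =
      C x * (lin u₀ u₁ ^ Q * lin v₀ v₁) + C y * (lin w₀ w₁ ^ Q * lin z₀ z₁)) :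
    a = x * (u₀ ^ Q * v₀) + y * (w₀ ^ Q * z₀) ∧ b = x * (u₀ ^ Q * v₁) + y * (w₀ ^ Q * z₁) ∧
      c = x * (u₁ ^ Q * v₀) + y * (w₁ ^ Q * z₀) ∧ d = x * (u₁ ^ Q * v₁) + y * (w₁ ^ Q * z₁) := by
  rw [lin_pow_mul_lin hQ, lin_pow_mul_lin hQ, polyA_combination] at h
  exact polyA_inj hQ2 h

variable [IsAlgClosed L]

/-- A pencil of forms without common zero either contains a form `l₁ ^ Q * l₂` with independent
linear forms `l₁`, `l₂`, or it is spanned by two `(Q + 1)`-st powers of linear forms. -/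
lemma pencil_dichotomy (hQ : Q = p ^ l) (hQ2 : 2 ≤ Q) {a b c d a' b' c' d' : L}
    (hcz : ∀ α, ¬ (VanishAt (Q + 1) (polyA Q a b c d) α ∧
      VanishAt (Q + 1) (polyA Q a' b' c' d') α)) :
    (∃ s t v₀ v₁ w₀ w₁ : L, ¬ (s = 0 ∧ t = 0) ∧ v₀ * w₁ - v₁ * w₀ ≠ 0 ∧
      C t * polyA Q a' b' c' d' - C s * polyA Q a b c d = lin v₀ v₁ ^ Q * lin w₀ w₁) ∨
    ∃ v₀ v₁ w₀ w₁ α₁ α₂ γ₁ γ₂ : L,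
      IsPowerPencil Q (polyA Q a b c d) (polyA Q a' b' c' d') v₀ v₁ w₀ w₁ α₁ α₂ γ₁ γ₂ := by
  have hQ0 : Q ≠ 0 := by omega
  set A := polyA Q a b c d with hA
  set B := polyA Q a' b' c' d' with hB
  rw [or_iff_not_imp_left]
  intro hno
  -- If a member vanished identically, a zero of A or of B would be common to both.
  have hne : ∀ s t : L, ¬ (s = 0 ∧ t = 0) → C t * B - C s * A ≠ 0 := by
    intro s t hst h0
    have hz : ∀ α, VanishAt (Q + 1) (C t * B - C s * A) α := by
      intro α
      rw [h0]
      induction α using OnePoint.rec with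
      | infty => simp [vanishAt_infty]
      | coe x => simp [vanishAt_coe]
    by_cases ht : t = 0
    · have hs : s ≠ 0 := fun hs => hst ⟨hs, ht⟩
      obtain ⟨α, hα⟩ := exists_vanishAt_polyA hQ2 a' b' c' d'
      refine hcz α (vanishAt_of_sub (s := s) (t := t) (s' := 0) (t' := 1) (by simpa using hs)
        (hz α) (by simpa using hα))
    · obtain ⟨α, hα⟩ := exists_vanishAt_polyA hQ2 a b c d
      refine hcz α (vanishAt_of_sub (s := s) (t := t) (s' := -1) (t' := 0) (by simpa using ht)
        (hz α) (by simpa using hα))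
  have hsing : ∀ s t : L, ¬ (s = 0 ∧ t = 0) →
      (t * a' - s * a) * (t * d' - s * d) - (t * b' - s * b) * (t * c' - s * c) = 0 →
      ∃ u₀ u₁ κ : L, ¬ (u₀ = 0 ∧ u₁ = 0) ∧ κ ≠ 0 ∧
        C t * B - C s * A = C κ * (lin u₀ u₁ ^ Q * lin u₀ u₁) := by
    intro s t hst hdet
    obtain ⟨u₀, u₁, v₀, v₁, h1, h2, h3, h4⟩ := exists_rank_one hQ0 hdet
    have hfac : C t * B - C s * A = lin u₀ u₁ ^ Q * lin v₀ v₁ := by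
      rw [hA, hB, polyA_sub, lin_pow_mul_lin hQ, h1, h2, h3, h4]
    have hu : ¬ (u₀ = 0 ∧ u₁ = 0) := by
      rintro ⟨rfl, rfl⟩
      exact hne s t hst (by simp [hfac, lin, hQ0])
    have huv : u₀ * v₁ - u₁ * v₀ = 0 := by
      by_contra huv
      exact hno ⟨s, t, u₀, u₁, v₀, v₁, hst, huv, hfac⟩
    obtain ⟨κ, rfl, rfl⟩ := exists_mul_eq_of_det_eq_zero hu huv
    have hfac' : C t * B - C s * A = C κ * (lin u₀ u₁ ^ Q * lin u₀ u₁) := by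
      rw [hfac, lin, lin, C_mul, C_mul]; ring
    refine ⟨u₀, u₁, κ, hu, ?_, hfac'⟩
    rintro rfl
    exact hne s t hst (by simp [hfac'])
  have hvan : ∀ u₀ u₁ κ : L, ¬ (u₀ = 0 ∧ u₁ = 0) → κ ≠ 0 →
      VanishAt (Q + 1) (C κ * (lin u₀ u₁ ^ Q * lin u₀ u₁)) (proj (-u₁) u₀) := by
    intro u₀ u₁ κ hu hκ
    rw [vanishAt_C_mul hκ, lin_pow_mul_lin hQ, vanishAt_polyA_proj hQ hQ2 hu]
    ring
  -- The quadratic form is the determinant of tB − sA.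
  obtain ⟨s, t, hst, hdet⟩ := exists_root_binary_quadratic (a * d - b * c)
    (-(a * d' + a' * d - b * c' - b' * c)) (a' * d' - b' * c')
  obtain ⟨u₀, u₁, κ, hu, hκ, hR⟩ := hsing s t hst (by linear_combination hdet)
  obtain ⟨s', t', hind⟩ : ∃ s' t' : L, s * t' - s' * t ≠ 0 := by
    by_cases ht : t = 0
    · exact ⟨0, 1, by simpa using fun hs => hst ⟨hs, ht⟩⟩
    · exact ⟨-1, 0, by simpa using ht⟩
  set m₁ := t' * a' - s' * a with hm₁
  set m₂ := t' * b' - s' * b with hm₂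
  set m₃ := t' * c' - s' * c with hm₃
  set m₄ := t' * d' - s' * d with hm₄
  -- This is the value of the second member at the zero of the first; it is nonzero since A and B
  -- have no common zero.
  have hbil : m₁ * (u₁ ^ Q * u₁) - m₂ * (u₁ ^ Q * u₀) - m₃ * (u₀ ^ Q * u₁) +
      m₄ * (u₀ ^ Q * u₀) ≠ 0 := by
    intro h0
    refine hcz _ (vanishAt_of_sub hind (hR ▸ hvan u₀ u₁ κ hu hκ) ?_)
    rw [hA, hB, polyA_sub, vanishAt_polyA_proj hQ hQ2 hu, h0]
  set bil := m₁ * (u₁ ^ Q * u₁) - m₂ * (u₁ ^ Q * u₀) - m₃ * (u₀ ^ Q * u₁) +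
      m₄ * (u₀ ^ Q * u₀) with hbildef
  have hR' := hR
  rw [hA, hB, polyA_sub, lin_pow_mul_lin hQ, C_mul_polyA] at hR'
  obtain ⟨r₁, r₂, r₃, r₄⟩ := polyA_inj hQ2 hR'
  -- Along the rank-one direction R = κ u^Q u the determinant is affine: det(M + τR) = det M + τ κ
  -- bil. Its unique zero τ gives a second singular member.
  set τ := -(m₁ * m₄ - m₂ * m₃) / (κ * bil) with hτ
  have hτ' : τ * κ * bil = -(m₁ * m₄ - m₂ * m₃) := by
    rw [hτ]; field_simp
  have hind' : s * (t' + τ * t) - (s' + τ * s) * t ≠ 0 := by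
    intro h0; exact hind (by linear_combination h0)
  have hst' : ¬ (s' + τ * s = 0 ∧ t' + τ * t = 0) := by
    rintro ⟨h1, h2⟩
    exact hind' (by rw [h1, h2]; ring)
  have e₁ : (t' + τ * t) * a' - (s' + τ * s) * a = m₁ + τ * (κ * (u₀ ^ Q * u₀)) := by
    linear_combination τ * r₁
  have e₂ : (t' + τ * t) * b' - (s' + τ * s) * b = m₂ + τ * (κ * (u₀ ^ Q * u₁)) := by
    linear_combination τ * r₂
  have e₃ : (t' + τ * t) * c' - (s' + τ * s) * c = m₃ + τ * (κ * (u₁ ^ Q * u₀)) := by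
    linear_combination τ * r₃
  have e₄ : (t' + τ * t) * d' - (s' + τ * s) * d = m₄ + τ * (κ * (u₁ ^ Q * u₁)) := by
    linear_combination τ * r₄
  obtain ⟨w₀, w₁, κ', hw, hκ', hR₂⟩ := hsing (s' + τ * s) (t' + τ * t) hst' (by
    rw [e₁, e₂, e₃, e₄]
    linear_combination hτ')
  set S := s' + τ * s
  set T := t' + τ * t
  set δ := s * T - S * t with hδ
  have huw : u₀ * w₁ - u₁ * w₀ ≠ 0 := by
    intro h0
    have hpp : proj (-u₁) u₀ = proj (-w₁) w₀ := by
      rw [proj_eq_proj_iff (by simpa [and_comm] using hu) (by simpa [and_comm] using hw)]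
      linear_combination h0
    refine hcz _ (vanishAt_of_sub hind' (hR ▸ hvan u₀ u₁ κ hu hκ) ?_)
    rw [hR₂, hpp]
    exact hvan w₀ w₁ κ' hw hκ'
  -- Cramer's rule expresses A and B through the two singular members.
  have hδi : C δ⁻¹ * (C s * C T - C S * C t) = (1 : L[X]) := by
    rw [← C_mul, ← C_mul, ← C_sub, ← C_mul, inv_mul_cancel₀ hind', C_1]
  refine ⟨u₀, u₁, w₀, w₁, -(δ⁻¹ * T * κ), δ⁻¹ * t * κ', -(δ⁻¹ * S * κ), δ⁻¹ * s * κ',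
    huw, ?_, ?_, ?_⟩
  · rw [show -(δ⁻¹ * T * κ) * (δ⁻¹ * s * κ') - δ⁻¹ * t * κ' * -(δ⁻¹ * S * κ) =
      -(δ⁻¹ * δ⁻¹ * κ * κ' * δ) by rw [hδ]; ring]
    simp [hκ, hκ', hind']
  · simp only [C_neg, C_mul]
    linear_combination -A * hδi + C δ⁻¹ * C t * hR₂ - C δ⁻¹ * C T * hR
  · simp only [C_neg, C_mul]
    linear_combination -B * hδi + C δ⁻¹ * C s * hR₂ - C δ⁻¹ * C S * hR

end Frobenius

/-! ### Common zeros and the symmetry x ↦ x^{-q} -/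

section Invariants

variable {L : Type*} [Field L] {p k l q Q : ℕ} [Fact p.Prime] [CharP L p]

/-- Vanishing at two distinct points cuts the four-dimensional space of forms down to a plane,
spanned by these two products; a and b fix r and s, and the two root equations give c and d. -/
lemma combination_of_two_roots (hQ : Q = p ^ l) {a b c d x y : L} (hxy : x - y ≠ 0)
    (hx : (polyA Q a b c d).eval x = 0) (hy : (polyA Q a b c d).eval y = 0) :
    ∃ r s : L, polyA Q a b c d =
      C r * (lin 1 (-x) ^ Q * lin 1 (-y)) + C s * (lin 1 (-y) ^ Q * lin 1 (-x)) := by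
  have hQ0 : Q ≠ 0 := hQ ▸ (pow_pos (Fact.out : p.Prime).pos l).ne'
  have hneg : ∀ z : L, (-z) ^ Q = -z ^ Q := by
    intro z
    have := sub_pow_char_pow (p := p) (n := l) 0 z
    rw [← hQ] at this
    simpa [hQ0] using this
  rw [eval_polyA, pow_succ] at hx hy
  refine ⟨(b + x * a) / (x - y), (-b - y * a) / (x - y), ?_⟩
  rw [lin_pow_mul_lin hQ, lin_pow_mul_lin hQ, polyA_combination, hneg, hneg, one_pow]
  congr 1
  · field_simp; ring
  · field_simp; ring
  · field_simp
    linear_combination hx - hy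
  · field_simp
    linear_combination -y * hx + x * hy

lemma eval_polyA_pow (hq : q = p ^ k) (a b c d x : L) :
    (polyA Q a b c d).eval x ^ q = (polyA Q (a ^ q) (b ^ q) (c ^ q) (d ^ q)).eval (x ^ q) := by
  subst hq
  rw [eval_polyA, eval_polyA, add_pow_char_pow, add_pow_char_pow, add_pow_char_pow, mul_pow,
    mul_pow, mul_pow]
  ring

omit [Fact p.Prime] [CharP L p] in
lemma eval_polyA_inv (a b c d : L) {z : L} (hz : z ≠ 0) :
    (polyA Q a b c d).eval z⁻¹ * z ^ (Q + 1) = (polyA Q d c b a).eval z := by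
  have h1 : z⁻¹ ^ Q * z ^ Q = 1 := by rw [← mul_pow, inv_mul_cancel₀ hz, one_pow]
  have h2 : z⁻¹ * z = 1 := inv_mul_cancel₀ hz
  rw [eval_polyA, eval_polyA, pow_succ, pow_succ]
  linear_combination (a * z⁻¹ * z + b * z) * h1 + (a + c * z ^ Q) * h2

/-- B is the reversal of A with coefficients raised to the q, and x^q = x⁻¹ on μ_{q+1}. -/
lemma eval_polyB_eq_zero (hq : q = p ^ k) {a b c d x : L} (hx : x ^ (q + 1) = 1)
    (h : (polyA Q a b c d).eval x = 0) : (polyB q Q a b c d).eval x = 0 := by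
  have hq0 : q ≠ 0 := hq ▸ (pow_pos (Fact.out : p.Prime).pos k).ne'
  have hx0 : x ≠ 0 := by rintro rfl; simp at hx
  have hxq : x ^ q = x⁻¹ := eq_inv_of_mul_eq_one_left (by rw [← pow_succ, hx])
  have h1 := eval_polyA_pow (Q := Q) hq a b c d x
  rw [h, zero_pow hq0, hxq] at h1
  have h2 := eval_polyA_inv (Q := Q) (a ^ q) (b ^ q) (c ^ q) (d ^ q) hx0
  rw [← h1, zero_mul] at h2
  exact h2.symm

/-- If the forms `A` and `B` have a common zero, then either `A` has a root in `μ_{q+1}`, or both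
forms are linear combinations of `l₁ ^ Q * l₂` and `l₂ ^ Q * l₁` for some `l₁`, `l₂`. -/
lemma exists_combination_of_common_zero (hq : q = p ^ k) (hQ : Q = p ^ l) (hQ2 : 2 ≤ Q)
    {a b c d : L} (ha : (a ^ q) ^ q = a) (hb : (b ^ q) ^ q = b) (hc : (c ^ q) ^ q = c)
    (hd : (d ^ q) ^ q = d)
    (hμ : ¬ ∃ x : L, x ^ (q + 1) = 1 ∧ (polyA Q a b c d).eval x = 0) {α : OnePoint L}
    (hA : VanishAt (Q + 1) (polyA Q a b c d) α)
    (hB : VanishAt (Q + 1) (polyB q Q a b c d) α) :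
    ∃ v₀ v₁ w₀ w₁ α₁ α₂ γ₁ γ₂ : L, v₀ * w₁ - v₁ * w₀ ≠ 0 ∧
      polyA Q a b c d =
        C α₁ * (lin v₀ v₁ ^ Q * lin w₀ w₁) + C α₂ * (lin w₀ w₁ ^ Q * lin v₀ v₁) ∧
      polyB q Q a b c d =
        C γ₁ * (lin v₀ v₁ ^ Q * lin w₀ w₁) + C γ₂ * (lin w₀ w₁ ^ Q * lin v₀ v₁) := by
  have hq0 : q ≠ 0 := hq ▸ (pow_pos (Fact.out : p.Prime).pos k).ne'
  have hQ0 : Q ≠ 0 := by omega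
  have hBA : polyB q Q a b c d = polyA Q (d ^ q) (c ^ q) (b ^ q) (a ^ q) := rfl
  rw [hBA] at hB ⊢
  -- A common zero at 0 or ∞ forces a = d = 0; then l₁ = X and l₂ = 1 serve.
  have hzero : a = 0 → d = 0 → ∃ v₀ v₁ w₀ w₁ α₁ α₂ γ₁ γ₂ : L, v₀ * w₁ - v₁ * w₀ ≠ 0 ∧
      polyA Q a b c d =
        C α₁ * (lin v₀ v₁ ^ Q * lin w₀ w₁) + C α₂ * (lin w₀ w₁ ^ Q * lin v₀ v₁) ∧
      polyA Q (d ^ q) (c ^ q) (b ^ q) (a ^ q) =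
        C γ₁ * (lin v₀ v₁ ^ Q * lin w₀ w₁) + C γ₂ * (lin w₀ w₁ ^ Q * lin v₀ v₁) := by
    rintro rfl rfl
    refine ⟨1, 0, 0, 1, b, c, c ^ q, b ^ q, by simp, ?_, ?_⟩ <;> simp [polyA, lin, hq0]
  induction α using OnePoint.rec with
  | infty =>
    rw [vanishAt_infty, coeff_polyA hQ2] at hA hB
    exact hzero hA (by simpa [hq0] using hB)
  | coe x =>
    rw [vanishAt_coe] at hA hB
    by_cases hx0 : x = 0
    · rw [hx0, eval_polyA] at hA hB
      exact hzero (by simpa [hQ0, hq0] using hB) (by simpa [hQ0] using hA)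
    · have hz : x ^ q ≠ 0 := pow_ne_zero q hx0
      have hA' : (polyA Q a b c d).eval (x ^ q)⁻¹ = 0 := by
        have h1 := eval_polyA_pow (Q := Q) hq (d ^ q) (c ^ q) (b ^ q) (a ^ q) x
        rw [hB, zero_pow hq0, ha, hb, hc, hd, ← eval_polyA_inv _ _ _ _ hz] at h1
        exact (mul_eq_zero.1 h1.symm).resolve_right (pow_ne_zero _ hz)
      have hB' : (polyA Q (d ^ q) (c ^ q) (b ^ q) (a ^ q)).eval (x ^ q)⁻¹ = 0 := by
        have h1 := eval_polyA_pow (Q := Q) hq a b c d x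
        rw [hA, zero_pow hq0, ← eval_polyA_inv _ _ _ _ hz] at h1
        exact (mul_eq_zero.1 h1.symm).resolve_right (pow_ne_zero _ hz)
      -- The fixed points of x ↦ x^{-q} are the elements of μ_{q+1}.
      have hxy : x - (x ^ q)⁻¹ ≠ 0 := by
        intro h0
        refine hμ ⟨x, ?_, hA⟩
        rw [pow_succ]
        nth_rewrite 2 [sub_eq_zero.1 h0]
        exact mul_inv_cancel₀ hz
      obtain ⟨α₁, α₂, h1⟩ := combination_of_two_roots hQ hxy hA hA'
      obtain ⟨γ₁, γ₂, h2⟩ := combination_of_two_roots hQ hxy hB hB'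
      exact ⟨_, _, _, _, α₁, α₂, γ₁, γ₂, by simpa [add_comm, sub_eq_add_neg] using hxy, h1, h2⟩

end Invariants

/-! ### Quadratic covariants in characteristic 2 -/

section CharTwo

variable {L : Type*} [Field L] {l Q : ℕ}

/-- The coordinates of the covariants of a pencil spanned by `l₁ ^ Q * l₂` and `l₃ ^ Q * l₄`. -/
lemma pencil_covariants {a b c d a' b' c' d' α₁ α₂ γ₁ γ₂ u₀ u₁ v₀ v₁ w₀ w₁ z₀ z₁ : L}
    (hA : a = α₁ * (u₀ * v₀) + α₂ * (w₀ * z₀) ∧ b = α₁ * (u₀ * v₁) + α₂ * (w₀ * z₁) ∧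
      c = α₁ * (u₁ * v₀) + α₂ * (w₁ * z₀) ∧ d = α₁ * (u₁ * v₁) + α₂ * (w₁ * z₁))
    (hB : a' = γ₁ * (u₀ * v₀) + γ₂ * (w₀ * z₀) ∧ b' = γ₁ * (u₀ * v₁) + γ₂ * (w₀ * z₁) ∧
      c' = γ₁ * (u₁ * v₀) + γ₂ * (w₁ * z₀) ∧ d' = γ₁ * (u₁ * v₁) + γ₂ * (w₁ * z₁)) :
    a * c' - c * a' = (α₁ * γ₂ - α₂ * γ₁) * (u₀ * w₁ - u₁ * w₀) * (v₀ * z₀) ∧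
    a * d' + b * c' - c * b' - d * a' =
      (α₁ * γ₂ - α₂ * γ₁) * (u₀ * w₁ - u₁ * w₀) * (v₀ * z₁ + v₁ * z₀) ∧
    b * d' - d * b' = (α₁ * γ₂ - α₂ * γ₁) * (u₀ * w₁ - u₁ * w₀) * (v₁ * z₁) ∧
    a * b' - b * a' = (α₁ * γ₂ - α₂ * γ₁) * (v₀ * z₁ - v₁ * z₀) * (u₀ * w₀) ∧
    a * d' + c * b' - b * c' - d * a' =
      (α₁ * γ₂ - α₂ * γ₁) * (v₀ * z₁ - v₁ * z₀) * (u₀ * w₁ + u₁ * w₀) ∧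
    c * d' - d * c' = (α₁ * γ₂ - α₂ * γ₁) * (v₀ * z₁ - v₁ * z₀) * (u₁ * w₁) ∧
    ∀ s t : L, (t * a' - s * a) * (t * d' - s * d) - (t * b' - s * b) * (t * c' - s * c) =
      (u₀ * w₁ - u₁ * w₀) * (v₀ * z₁ - v₁ * z₀) *
        ((t * γ₁ - s * α₁) * (t * γ₂ - s * α₂)) := by
  obtain ⟨rfl, rfl, rfl, rfl⟩ := hA
  obtain ⟨rfl, rfl, rfl, rfl⟩ := hB
  refine ⟨?_, ?_, ?_, ?_, ?_, ?_, fun s t => ?_⟩ <;> ring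

variable [CharP L 2]

/-- `pencil_covariants` is applied with Q-th powers as left factors. The two kinds of pencil differ
only by exchanging the right factors, which the symmetric products do not see and which changes F by
a sign, invisible in characteristic 2. -/
lemma standard_pencil_covariants (hQ : Q = 2 ^ l) (hQ2 : 2 ≤ Q)
    {a b c d a' b' c' d' v₀ v₁ w₀ w₁ α₁ α₂ γ₁ γ₂ : L}
    (h : IsPowerPencil Q (polyA Q a b c d) (polyA Q a' b' c' d') v₀ v₁ w₀ w₁ α₁ α₂ γ₁ γ₂ ∨
      IsTwistedPencil Q (polyA Q a b c d) (polyA Q a' b' c' d') v₀ v₁ w₀ w₁ α₁ α₂ γ₁ γ₂) :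
    ∃ Δ F : L, Δ ≠ 0 ∧ F ≠ 0 ∧ F = v₀ * w₁ + v₁ * w₀ ∧
      a * c' + c * a' = Δ * F ^ Q * (v₀ * w₀) ∧
      a * d' + b * c' + c * b' + d * a' = Δ * F ^ Q * (v₀ * w₁ + v₁ * w₀) ∧
      b * d' + d * b' = Δ * F ^ Q * (v₁ * w₁) ∧
      a * b' + b * a' = Δ * F * (v₀ * w₀) ^ Q ∧
      ∀ s t : L, (b * c + a * d) * s ^ 2 + (a * d' + b * c' + c * b' + d * a') * s * t +
        (a' * d' + b' * c') * t ^ 2 =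
        F ^ Q * F * ((t * γ₁ - s * α₁) * (t * γ₂ - s * α₂)) := by
  have : Fact (Nat.Prime 2) := ⟨Nat.prime_two⟩
  have hF : (v₀ * w₁ - v₁ * w₀) ^ Q = v₀ ^ Q * w₁ ^ Q - v₁ ^ Q * w₀ ^ Q := det_pow hQ _ _ _ _
  rcases h with h | h
  · obtain ⟨e1, e2, e3, e4, -, -, e7⟩ := pencil_covariants
      (coeffs_of_eq_combination hQ hQ2 h.left) (coeffs_of_eq_combination hQ hQ2 h.right)
    refine ⟨α₁ * γ₂ - α₂ * γ₁, v₀ * w₁ - v₁ * w₀, h.coeffs, h.forms, CharTwo.sub_eq_add _ _, ?_⟩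
    rw [← hF] at e1 e2 e3 e7
    simp only [CharTwo.sub_eq_add] at *
    refine ⟨e1, e2, e3, by rw [e4, mul_pow], fun s t => ?_⟩
    rw [← e7]; ring
  · obtain ⟨e1, e2, e3, e4, -, -, e7⟩ := pencil_covariants
      (coeffs_of_eq_combination hQ hQ2 h.left) (coeffs_of_eq_combination hQ hQ2 h.right)
    refine ⟨α₁ * γ₂ - α₂ * γ₁, v₀ * w₁ - v₁ * w₀, h.coeffs, h.forms, CharTwo.sub_eq_add _ _, ?_⟩
    rw [← hF] at e1 e2 e3 e7
    simp only [CharTwo.sub_eq_add] at *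
    refine ⟨by rw [e1]; ring, by rw [e2]; ring, by rw [e3]; ring, by rw [e4, mul_pow]; ring,
      fun s t => ?_⟩
    rw [show v₀ * w₁ + v₁ * w₀ = w₀ * v₁ + w₁ * v₀ by ring] at e7 ⊢
    rw [← e7]; ring

variable [IsAlgClosed L]

/-- Since e is the middle coefficient of the determinant form, e ≠ 0 yields two independent singular
members u^Q v and w^Q z. The criterion, after extracting Q-th roots, says vz = κ uw; unique
factorisation then matches v and z with u and w. -/
lemma exists_pencil_of_criterion (hQ : Q = 2 ^ l) (hQ2 : 2 ≤ Q)
    {a b c d a' b' c' d' e : L} (he : e = a * d' + b * c' + c * b' + d * a') (he0 : e ≠ 0)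
    (h2 : (a * c' + c * a') ^ Q = e ^ (Q - 1) * (a * b' + b * a'))
    (h0 : (b * d' + d * b') ^ Q = e ^ (Q - 1) * (c * d' + d * c')) :
    ∃ v₀ v₁ w₀ w₁ α₁ α₂ γ₁ γ₂ : L,
      IsPowerPencil Q (polyA Q a b c d) (polyA Q a' b' c' d') v₀ v₁ w₀ w₁ α₁ α₂ γ₁ γ₂ ∨
      IsTwistedPencil Q (polyA Q a b c d) (polyA Q a' b' c' d') v₀ v₁ w₀ w₁ α₁ α₂ γ₁ γ₂ := by
  have : Fact (Nat.Prime 2) := ⟨Nat.prime_two⟩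
  have hQ0 : Q ≠ 0 := by omega
  have two : (2 : L) = 0 := CharTwo.two_eq_zero
  obtain ⟨s, t, s', t', hδ, hst, hst'⟩ :=
    exists_independent_roots_binary_quadratic (x := a * d - b * c) (y := e)
      (z := a' * d' - b' * c') he0
  have hdet : ∀ s t : L, (a * d - b * c) * s ^ 2 + e * s * t + (a' * d' - b' * c') * t ^ 2 = 0 →
      (t * a' - s * a) * (t * d' - s * d) - (t * b' - s * b) * (t * c' - s * c) = 0 := by
    intro s t h
    rw [he] at h
    linear_combination h - (s * t * (a * d' + d * a')) * two
  obtain ⟨u₀, u₁, v₀, v₁, r₁, r₂, r₃, r₄⟩ := exists_rank_one hQ0 (hdet s t hst)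
  obtain ⟨w₀, w₁, z₀, z₁, r₁', r₂', r₃', r₄'⟩ := exists_rank_one hQ0 (hdet s' t' hst')
  set δ := s * t' - s' * t with hδdef
  -- Cramer's rule: coordinates of A and B in the basis of singular members.
  obtain ⟨α₁, hα₁⟩ : ∃ x, x = -(t' / δ) := ⟨_, rfl⟩
  obtain ⟨α₂, hα₂⟩ : ∃ x, x = t / δ := ⟨_, rfl⟩
  obtain ⟨γ₁, hγ₁⟩ : ∃ x, x = -(s' / δ) := ⟨_, rfl⟩
  obtain ⟨γ₂, hγ₂⟩ : ∃ x, x = s / δ := ⟨_, rfl⟩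
  have hcomb : ∀ {x x' y y' : L}, t * x' - s * x = y → t' * x' - s' * x = y' →
      x = α₁ * y + α₂ * y' ∧ x' = γ₁ * y + γ₂ * y' := by
    intro x x' y y' h h'
    rw [← h, ← h', hα₁, hα₂, hγ₁, hγ₂]
    constructor
    · field_simp
      rw [hδdef]; ring
    · field_simp
      rw [hδdef]; ring
  obtain ⟨a1, a1'⟩ := hcomb r₁ r₁'
  obtain ⟨a2, a2'⟩ := hcomb r₂ r₂'
  obtain ⟨a3, a3'⟩ := hcomb r₃ r₃'
  obtain ⟨a4, a4'⟩ := hcomb r₄ r₄'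
  obtain ⟨e1, e2, e3, e4, e5, e6, -⟩ := pencil_covariants ⟨a1, a2, a3, a4⟩ ⟨a1', a2', a3', a4'⟩
  rw [← det_pow hQ] at e1 e2 e3
  have ee2 : e = a * d' + b * c' - c * b' - d * a' := by
    rw [he]; simp only [CharTwo.sub_eq_add]
  have ee5 : e = a * d' + c * b' - b * c' - d * a' := by
    rw [he]; simp only [CharTwo.sub_eq_add]; ring
  rw [← ee2] at e2
  rw [← ee5] at e5
  rw [CharTwo.sub_eq_add] at e1 e3 e4 e6
  rw [e1, e4] at h2
  rw [e3, e6] at h0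
  have hmid : e ^ Q = e ^ (Q - 1) * e := by rw [← pow_succ]; congr 1; omega
  have hΔ : α₁ * γ₂ - α₂ * γ₁ ≠ 0 := by
    intro h; exact he0 (by rw [e2, h]; ring)
  have hD : u₀ * w₁ - u₁ * w₀ ≠ 0 := by
    intro h; exact he0 (by rw [e2, h, zero_pow hQ0]; ring)
  have hF : v₀ * z₁ - v₁ * z₀ ≠ 0 := by
    intro h; exact he0 (by rw [e5, h]; ring)
  set Δ := α₁ * γ₂ - α₂ * γ₁
  set F := v₀ * z₁ - v₁ * z₀
  set D := u₀ * w₁ - u₁ * w₀ with hDdef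
  -- κ is the ratio of vz to uw, found by comparing the scalar factors of the two covariants;
  -- `hroot` then uses injectivity of Frobenius.
  obtain ⟨κ, hκ⟩ := IsAlgClosed.exists_pow_nat_eq (e ^ (Q - 1) * (Δ * F) / (Δ * D ^ Q) ^ Q)
    (Nat.pos_of_ne_zero hQ0)
  have hκ' : κ ^ Q * (Δ * D ^ Q) ^ Q = e ^ (Q - 1) * (Δ * F) := by
    rw [hκ]; field_simp
  have hκ0 : κ ≠ 0 := by
    rintro rfl
    rw [zero_pow hQ0, zero_mul] at hκ'
    exact mul_ne_zero (pow_ne_zero _ he0) (mul_ne_zero hΔ hF) hκ'.symm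
  have hroot : ∀ {x y : L}, (Δ * D ^ Q * x) ^ Q = e ^ (Q - 1) * (Δ * F * y ^ Q) → x = κ * y := by
    intro x y hxy
    have hinj : (x - κ * y) ^ Q = 0 := by
      rw [hQ, sub_pow_char_pow, ← hQ, mul_pow]
      refine (mul_eq_zero.1 (?_ : (Δ * D ^ Q) ^ Q * (x ^ Q - κ ^ Q * y ^ Q) = 0)).resolve_left
        (pow_ne_zero _ (mul_ne_zero hΔ (pow_ne_zero _ hD)))
      rw [mul_pow] at hxy
      linear_combination hxy - y ^ Q * hκ'
    exact sub_eq_zero.1 (pow_eq_zero_iff hQ0 |>.1 hinj)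
  have f2 : v₀ * z₀ = κ * (u₀ * w₀) := hroot (by rw [h2, mul_pow])
  have f0 : v₁ * z₁ = κ * (u₁ * w₁) := hroot (by rw [h0, mul_pow])
  -- No hypothesis is needed for the middle coefficients: both equal e, and e^Q = e^{Q-1} e.
  have f1 : v₀ * z₁ + v₁ * z₀ = κ * (u₀ * w₁ + u₁ * w₀) := by
    refine hroot ?_
    rw [← e2, hmid, hQ, add_pow_char_pow, ← hQ, mul_pow, mul_pow, ← e5]
  -- Evaluate vz = κ uw at the zero of v, and below at that of z. If u vanishes with v the pencil is
  -- a power pencil, if w does it is twisted.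
  have g1 : (u₀ * v₁ - u₁ * v₀) * (w₀ * v₁ - w₁ * v₀) = 0 := by
    refine (mul_eq_zero.1 (?_ : κ * _ = 0)).resolve_left hκ0
    linear_combination -v₁ ^ 2 * f2 + v₀ * v₁ * f1 - v₀ ^ 2 * f0
  have g2 : (u₀ * z₁ - u₁ * z₀) * (w₀ * z₁ - w₁ * z₀) = 0 := by
    refine (mul_eq_zero.1 (?_ : κ * _ = 0)).resolve_left hκ0
    linear_combination -z₁ ^ 2 * f2 + z₀ * z₁ * f1 - z₀ ^ 2 * f0
  have hu := not_both_zero_left hD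
  have hw := not_both_zero_right hD
  have hA : polyA Q a b c d =
      C α₁ * (lin u₀ u₁ ^ Q * lin v₀ v₁) + C α₂ * (lin w₀ w₁ ^ Q * lin z₀ z₁) := by
    rw [lin_pow_mul_lin hQ, lin_pow_mul_lin hQ, polyA_combination, ← a1, ← a2, ← a3, ← a4]
  have hB : polyA Q a' b' c' d' =
      C γ₁ * (lin u₀ u₁ ^ Q * lin v₀ v₁) + C γ₂ * (lin w₀ w₁ ^ Q * lin z₀ z₁) := by
    rw [lin_pow_mul_lin hQ, lin_pow_mul_lin hQ, polyA_combination, ← a1', ← a2', ← a3', ← a4']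
  have hlin : ∀ x y z : L, lin (x * y) (x * z) = C x * lin y z := by
    intro x y z; simp only [lin, C_mul]; ring
  rcases mul_eq_zero.1 g1 with h | h
  · obtain ⟨κ₁, rfl, rfl⟩ := exists_mul_eq_of_det_eq_zero hu h
    have hz : w₀ * z₁ - w₁ * z₀ = 0 := by
      refine (mul_eq_zero.1 g2).resolve_left fun h' => hF ?_
      linear_combination κ₁ * h'
    obtain ⟨κ₂, rfl, rfl⟩ := exists_mul_eq_of_det_eq_zero hw hz
    have hκκ : κ₁ * κ₂ ≠ 0 := by
      intro h'
      exact hF (by linear_combination D * h')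
    refine ⟨u₀, u₁, w₀, w₁, α₁ * κ₁, α₂ * κ₂, γ₁ * κ₁, γ₂ * κ₂, Or.inl ⟨hD, ?_, ?_, ?_⟩⟩
    · rw [show α₁ * κ₁ * (γ₂ * κ₂) - α₂ * κ₂ * (γ₁ * κ₁) = Δ * (κ₁ * κ₂) by ring]
      exact mul_ne_zero hΔ hκκ
    · rw [hA, hlin, hlin, C_mul, C_mul]; ring
    · rw [hB, hlin, hlin, C_mul, C_mul]; ring
  · obtain ⟨κ₁, rfl, rfl⟩ := exists_mul_eq_of_det_eq_zero hw h
    have hz : u₀ * z₁ - u₁ * z₀ = 0 := by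
      refine (mul_eq_zero.1 g2).resolve_right fun h' => hF ?_
      linear_combination κ₁ * h'
    obtain ⟨κ₂, rfl, rfl⟩ := exists_mul_eq_of_det_eq_zero hu hz
    have hκκ : κ₁ * κ₂ ≠ 0 := by
      intro h'
      exact hF (by linear_combination -D * h')
    refine ⟨u₀, u₁, w₀, w₁, α₁ * κ₁, α₂ * κ₂, γ₁ * κ₁, γ₂ * κ₂, Or.inr ⟨hD, ?_, ?_, ?_⟩⟩
    · rw [show α₁ * κ₁ * (γ₂ * κ₂) - α₂ * κ₂ * (γ₁ * κ₁) = Δ * (κ₁ * κ₂) by ring]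
      exact mul_ne_zero hΔ hκκ
    · rw [hA, hlin, hlin, C_mul, C_mul]; ring
    · rw [hB, hlin, hlin, C_mul, C_mul]; ring

end CharTwo

/-! ### Normal forms and the common factor -/

section NormalForms

variable {L : Type*} [Field L]

/-- The pencil of `A` and `B` is, up to the common factor `G`, spanned by the `n`-th powers of two
independent linear forms. -/
structure IsNormalForm (n : ℕ) (G A B : L[X]) (v₀ v₁ w₀ w₁ α₁ α₂ γ₁ γ₂ : L) : Prop where
  forms : v₀ * w₁ - v₁ * w₀ ≠ 0
  coeffs : α₁ * γ₂ - α₂ * γ₁ ≠ 0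
  left : A = G * (C α₁ * lin v₀ v₁ ^ n + C α₂ * lin w₀ w₁ ^ n)
  right : B = G * (C γ₁ * lin v₀ v₁ ^ n + C γ₂ * lin w₀ w₁ ^ n)

variable {A B G : L[X]} {n Q : ℕ} {v₀ v₁ w₀ w₁ α₁ α₂ γ₁ γ₂ : L}

lemma IsPowerPencil.isNormalForm (h : IsPowerPencil Q A B v₀ v₁ w₀ w₁ α₁ α₂ γ₁ γ₂) :
    IsNormalForm (Q + 1) 1 A B v₀ v₁ w₀ w₁ α₁ α₂ γ₁ γ₂ :=
  ⟨h.forms, h.coeffs, by rw [h.left, pow_succ, pow_succ, one_mul],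
    by rw [h.right, pow_succ, pow_succ, one_mul]⟩

lemma IsTwistedPencil.isNormalForm (hQ : Q ≠ 0)
    (h : IsTwistedPencil Q A B v₀ v₁ w₀ w₁ α₁ α₂ γ₁ γ₂) :
    IsNormalForm (Q - 1) (lin v₀ v₁ * lin w₀ w₁) A B v₀ v₁ w₀ w₁ α₁ α₂ γ₁ γ₂ := by
  obtain ⟨m, rfl⟩ := Nat.exists_eq_succ_of_ne_zero hQ
  refine ⟨h.forms, h.coeffs, ?_, ?_⟩
  · rw [h.left, Nat.succ_sub_one, Nat.succ_eq_add_one, pow_succ, pow_succ]; ring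
  · rw [h.right, Nat.succ_sub_one, Nat.succ_eq_add_one, pow_succ, pow_succ]; ring

lemma IsPowerPencil.swap (h : IsPowerPencil Q A B v₀ v₁ w₀ w₁ α₁ α₂ γ₁ γ₂) :
    IsPowerPencil Q A B w₀ w₁ v₀ v₁ α₂ α₁ γ₂ γ₁ :=
  ⟨fun h' => h.forms (by linear_combination -h'), fun h' => h.coeffs (by linear_combination -h'),
    by rw [h.left, add_comm], by rw [h.right, add_comm]⟩

lemma IsNormalForm.ratio_eq (h : IsNormalForm n G A B v₀ v₁ w₀ w₁ α₁ α₂ γ₁ γ₂) (hG : G ≠ 0) :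
    algebraMap L[X] (RatFunc L) B / algebraMap L[X] (RatFunc L) A =
      powerRat n v₀ v₁ w₀ w₁ α₁ α₂ γ₁ γ₂ := by
  have hG' : algebraMap L[X] (RatFunc L) G ≠ 0 := by simpa using hG
  rw [h.left, h.right, map_mul, map_mul, mul_div_mul_left _ _ hG', powerRat]

/-- The cofactors of G are coprime, so G is a greatest common divisor of A and B. -/
lemma IsNormalForm.dvd_of_dvd (h : IsNormalForm n G A B v₀ v₁ w₀ w₁ α₁ α₂ γ₁ γ₂) {H : L[X]}
    (hA : H ∣ A) (hB : H ∣ B) : H ∣ G := by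
  obtain ⟨x, y, hxy⟩ := isCoprime_power_pencil (n := n) h.forms h.coeffs
  rw [h.left] at hA
  rw [h.right] at hB
  have := dvd_add (hB.mul_left x) (hA.mul_left y)
  rwa [show ∀ N D : L[X], x * (G * N) + y * (G * D) = G * (x * N + y * D) by intros; ring, hxy,
    mul_one] at this

lemma IsNormalForm.eval_eq_zero (h : IsNormalForm n G A B v₀ v₁ w₀ w₁ α₁ α₂ γ₁ γ₂) {x : L}
    (hA : A.eval x = 0) (hB : B.eval x = 0) : G.eval x = 0 := by
  rw [← IsRoot, ← dvd_iff_isRoot] at hA hB ⊢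
  exact h.dvd_of_dvd hA hB

lemma coeff_eq_zero_of_isUnit_lin {u v : L} (h : IsUnit (lin u v)) : u = 0 := by
  obtain ⟨c, -, hc⟩ := isUnit_iff.1 h
  rw [← coeff_lin_one u v, ← hc]
  simp

/-- A fibre of the reduced function which is totally ramified. -/
lemma evalP1_powerRat_eq_iff_of_eval_lin_eq_zero (hn : n ≠ 0) (hvw : v₀ * w₁ - v₁ * w₀ ≠ 0)
    (hΔ : α₁ * γ₂ - α₂ * γ₁ ≠ 0) {x : L} (hx : (lin v₀ v₁).eval x = 0) (β : OnePoint L) :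
    evalP1 (powerRat n v₀ v₁ w₀ w₁ α₁ α₂ γ₁ γ₂) β = proj γ₂ α₂ ↔ β = OnePoint.some x := by
  have hx' : OnePoint.some x = proj (-v₁) v₀ :=
    (vanishAt_lin (not_both_zero_left hvw) (OnePoint.some x)).1 hx
  rw [hx']
  refine evalP1_powerRat_eq_iff_left hvw hn hΔ ?_ (by ring) β
  rintro ⟨h1, h2⟩
  exact hΔ (by rw [h1, h2]; ring)

/-- If the coefficient of `X²` in a nonzero multiple of `l₁ l₂` and its constant coefficient vanish
simultaneously, and this multiple divides `α l₁^{Q+1} + β l₂^{Q+1}`, then the latter is a multiple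
of `X^{Q+1}`. -/
lemma IsPowerPencil.eq_C_mul_X_pow_of_dvd (h : IsPowerPencil Q A B v₀ v₁ w₀ w₁ α₁ α₂ γ₁ γ₂)
    (hdvd : lin v₀ v₁ * lin w₀ w₁ ∣ A) (h01 : v₀ * w₀ = 0 → v₁ * w₁ = 0) (hα₂ : α₂ ≠ 0) :
    ∃ r, A = C r * X ^ (Q + 1) := by
  -- Here l₁ divides α₂ l₂^{Q+1} but is coprime to l₂, so as a polynomial it is a constant: its zero
  -- is at ∞. Two independent forms cannot both vanish there, which forces α₁ = 0 below.
  have key : ∀ {v₀ v₁ w₀ w₁ α₁ α₂ γ₁ γ₂ : L}, IsPowerPencil Q A B v₀ v₁ w₀ w₁ α₁ α₂ γ₁ γ₂ →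
      lin v₀ v₁ ∣ A → α₂ ≠ 0 → v₀ = 0 := by
    intro v₀ v₁ w₀ w₁ α₁ α₂ γ₁ γ₂ h hdvd hα₂
    have h1 : lin v₀ v₁ ∣ C α₂ * (lin w₀ w₁ ^ Q * lin w₀ w₁) := by
      rw [h.left] at hdvd
      exact (dvd_add_right ⟨C α₁ * lin v₀ v₁ ^ Q, by ring⟩).1 hdvd
    have hcop := isCoprime_lin h.forms
    have hu : IsUnit (C α₂ : L[X]) := isUnit_C.2 hα₂.isUnit
    exact coeff_eq_zero_of_isUnit_lin
      ((hcop.pow_right.mul_right hcop).isUnit_of_dvd' dvd_rfl (hu.dvd_mul_left.1 h1))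
  have hv₀ : v₀ = 0 := key h (dvd_of_mul_right_dvd hdvd) hα₂
  have hforms := h.forms
  have hw₀ : w₀ ≠ 0 := by rintro rfl; exact hforms (by rw [hv₀]; ring)
  have hv₁ : v₁ ≠ 0 := by rintro rfl; exact hforms (by rw [hv₀]; ring)
  have hα₁ : α₁ = 0 := by
    by_contra hα₁
    exact hw₀ (key h.swap (dvd_of_mul_left_dvd hdvd) hα₁)
  have hw₁ : w₁ = 0 := (mul_eq_zero.1 (h01 (by rw [hv₀, zero_mul]))).resolve_left hv₁
  refine ⟨α₂ * w₀ ^ (Q + 1), ?_⟩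
  rw [h.left, hα₁, hw₁, lin, lin]
  simp only [C_0, C_mul, C_pow]
  ring

end NormalForms

/-! ### Passage to the algebraic closure, and Λ in homogeneous coordinates -/

section OverExtension

variable {K : Type*} [Field K] {L : Type*} [Field L] [Algebra K L] {q Q : ℕ} {a b c d : K}

lemma map_polyA : (polyA Q a b c d).map (algebraMap K L) =
    polyA Q (algebraMap K L a) (algebraMap K L b) (algebraMap K L c) (algebraMap K L d) := by
  simp [polyA]

lemma map_polyB : (polyB q Q a b c d).map (algebraMap K L) =
    polyB q Q (algebraMap K L a) (algebraMap K L b) (algebraMap K L c) (algebraMap K L d) := by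
  simp [polyB]

lemma map_elemE : algebraMap K L (elemE q a b c d) =
    elemE q (algebraMap K L a) (algebraMap K L b) (algebraMap K L c) (algebraMap K L d) := by
  simp [elemE]

lemma proj_mem_setLambda_iff {s t : L} (hst : ¬ (s = 0 ∧ t = 0)) :
    proj s t ∈ setLambda L q a b c d ↔
      algebraMap K L (b * c + a * d) * s ^ 2 + algebraMap K L (elemE q a b c d) * s * t +
        algebraMap K L ((b * c + a * d) ^ q) * t ^ 2 = 0 := by
  by_cases ht : t = 0
  · have hs : s ≠ 0 := fun hs => hst ⟨hs, ht⟩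
    rw [proj_of_eq_zero ht, ht]
    have h1 : (polyW q a b c d).natDegree < 2 ↔ b * c + a * d = 0 := by
      constructor
      · intro h
        by_contra h0
        rw [polyW, natDegree_quadratic h0] at h
        exact lt_irrefl _ h
      · intro h
        rw [polyW, h]
        simp only [C_0, zero_mul, zero_add]
        exact natDegree_linear_le.trans_lt one_lt_two
    have h2 : algebraMap K L (b * c + a * d) * s ^ 2 + algebraMap K L (elemE q a b c d) * s * 0 +
        algebraMap K L ((b * c + a * d) ^ q) * 0 ^ 2 = 0 ↔ b * c + a * d = 0 := by
      rw [← map_eq_zero (algebraMap K L)]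
      simp [hs, -map_add, -map_mul, -map_eq_zero]
    refine Iff.trans ?_ (h1.trans h2.symm)
    simp [setLambda]
  · rw [proj_of_ne_zero ht]
    have h1 : aeval (s / t) (polyW q a b c d) * t ^ 2 =
        algebraMap K L (b * c + a * d) * s ^ 2 + algebraMap K L (elemE q a b c d) * s * t +
        algebraMap K L ((b * c + a * d) ^ q) * t ^ 2 := by
      simp only [polyW, map_add, map_mul, aeval_C, aeval_X, map_pow]
      field_simp
    rw [← h1]
    simp [setLambda, ht]

end OverExtension

/-! ### Geometric shapes of B / A -/

section Geometry

variable {L : Type*} [Field L] [IsAlgClosed L] {p k l q Q : ℕ} [Fact p.Prime] [CharP L p]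

-- Finite points give coprimality and the point ∞ gives full degree, so B / A is already reduced.
omit [Fact p.Prime] [CharP L p] in
lemma isCoprime_of_no_common_zero {a b c d a' b' c' d' : L}
    (hcz : ∀ α, ¬ (VanishAt (Q + 1) (polyA Q a b c d) α ∧
      VanishAt (Q + 1) (polyA Q a' b' c' d') α)) :
    IsCoprime (polyA Q a' b' c' d') (polyA Q a b c d) ∧
      max (polyA Q a' b' c' d').natDegree (polyA Q a b c d).natDegree = Q + 1 := by
  constructor
  · rw [isCoprime_iff_aeval_ne_zero_of_isAlgClosed L L]
    intro x
    by_contra! h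
    exact hcz (OnePoint.some x) ⟨by simpa [vanishAt_coe] using h.2, by simpa [vanishAt_coe] using h.1⟩
  · refine le_antisymm (max_le (natDegree_polyA_le _ _ _ _) (natDegree_polyA_le _ _ _ _)) ?_
    by_contra! hlt
    rw [max_lt_iff] at hlt
    exact hcz OnePoint.infty
      ⟨coeff_eq_zero_of_natDegree_lt hlt.2, coeff_eq_zero_of_natDegree_lt hlt.1⟩

omit [IsAlgClosed L] in
lemma polyA_ne_zero (hQ2 : 2 ≤ Q) {a b c d : L} (h : ¬ (a = 0 ∧ b = 0 ∧ c = 0 ∧ d = 0)) :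
    polyA Q a b c d ≠ 0 := by
  intro h0
  refine h (polyA_inj hQ2 (h0.trans ?_))
  simp [polyA]

omit [IsAlgClosed L] in
/-- Two dependent combinations of `R` and `S` have a constant ratio. -/
lemma exists_ratio_eq_C {A B R S : L[X]} {α₁ α₂ γ₁ γ₂ : L} (hA0 : A ≠ 0)
    (hA : A = C α₁ * R + C α₂ * S) (hB : B = C γ₁ * R + C γ₂ * S)
    (hΔ : α₁ * γ₂ - α₂ * γ₁ = 0) :
    ∃ z : L, algebraMap L[X] (RatFunc L) B / algebraMap L[X] (RatFunc L) A = RatFunc.C z := by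
  have hα : ¬ (α₁ = 0 ∧ α₂ = 0) := by
    rintro ⟨rfl, rfl⟩
    exact hA0 (by rw [hA]; simp)
  obtain ⟨z, rfl, rfl⟩ := exists_mul_eq_of_det_eq_zero hα hΔ
  refine ⟨z, ?_⟩
  have hA0' : algebraMap L[X] (RatFunc L) A ≠ 0 := by simpa using hA0
  have hBA : B = C z * A := by rw [hB, hA, C_mul, C_mul]; ring
  rw [hBA, map_mul, RatFunc.algebraMap_C, mul_div_cancel_right₀ _ hA0']

omit [IsAlgClosed L] [Fact p.Prime] [CharP L p] in
lemma isLinearMonomialLinear_of_pencil (hQ : Q ≠ 0) {A B : L[X]}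
    {v₀ v₁ w₀ w₁ α₁ α₂ γ₁ γ₂ : L}
    (h : IsPowerPencil Q A B v₀ v₁ w₀ w₁ α₁ α₂ γ₁ γ₂ ∨
      IsTwistedPencil Q A B v₀ v₁ w₀ w₁ α₁ α₂ γ₁ γ₂) :
    IsLinearMonomialLinear Q
      (algebraMap L[X] (RatFunc L) B / algebraMap L[X] (RatFunc L) A) := by
  rcases h with h | h
  · rw [h.isNormalForm.ratio_eq one_ne_zero]
    exact isLinearMonomialLinear_powerRat h.forms h.coeffs (Or.inr rfl)
  · rw [(h.isNormalForm hQ).ratio_eq (mul_ne_zero (lin_ne_zero (not_both_zero_left h.forms))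
      (lin_ne_zero (not_both_zero_right h.forms)))]
    exact isLinearMonomialLinear_powerRat h.forms h.coeffs (Or.inl rfl)

/-- The possible geometric shapes of `B / A`. -/
lemma ramification_cases (hq : q = p ^ k) (hQ : Q = p ^ l) (hQ2 : 2 ≤ Q)
    {a b c d : L} (ha : (a ^ q) ^ q = a) (hb : (b ^ q) ^ q = b) (hc : (c ^ q) ^ q = c)
    (hd : (d ^ q) ^ q = d) (habcd : ¬ (a = 0 ∧ b = 0 ∧ c = 0 ∧ d = 0))
    {g : RatFunc L} (hg : g = algebraMap L[X] (RatFunc L) (polyB q Q a b c d) /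
      algebraMap L[X] (RatFunc L) (polyA Q a b c d)) :
    (∃ β : OnePoint L, ramMultiset g β = {1, Q}) ∨ IsLinearMonomialLinear Q g ∨
      (∃ z : L, g = RatFunc.C z) ∨
      ∃ x : L, x ^ (q + 1) = 1 ∧ (polyA Q a b c d).eval x = 0 := by
  have hQ0 : Q ≠ 0 := by omega
  have hA0 := polyA_ne_zero hQ2 habcd
  by_cases hμ : ∃ x : L, x ^ (q + 1) = 1 ∧ (polyA Q a b c d).eval x = 0
  · exact Or.inr (Or.inr (Or.inr hμ))
  by_cases hcz : ∀ α, ¬ (VanishAt (Q + 1) (polyA Q a b c d) α ∧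
      VanishAt (Q + 1) (polyB q Q a b c d) α)
  · obtain ⟨hcop, hdeg⟩ := isCoprime_of_no_common_zero hcz
    rcases pencil_dichotomy hQ hQ2 hcz with
      ⟨s, t, v₀, v₁, w₀, w₁, hst, hvw, h⟩ | ⟨v₀, v₁, w₀, w₁, α₁, α₂, γ₁, γ₂, h⟩
    · exact Or.inl ⟨proj s t, hg ▸ ramMultiset_eq hcop hA0 hQ0 hdeg hst hvw h⟩
    · exact Or.inr (Or.inl (hg ▸ isLinearMonomialLinear_of_pencil hQ0 (Or.inl h)))
  · push Not at hcz
    obtain ⟨α, hA, hB⟩ := hcz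
    obtain ⟨v₀, v₁, w₀, w₁, α₁, α₂, γ₁, γ₂, hvw, h1, h2⟩ :=
      exists_combination_of_common_zero hq hQ hQ2 ha hb hc hd hμ hA hB
    by_cases hΔ : α₁ * γ₂ - α₂ * γ₁ = 0
    · exact Or.inr (Or.inr (Or.inl (hg ▸ exists_ratio_eq_C hA0 h1 h2 hΔ)))
    · exact Or.inr (Or.inl (hg ▸ isLinearMonomialLinear_of_pencil hQ0 (Or.inr ⟨hvw, hΔ, h1, h2⟩)))

/-- If `B / A` is equivalent to `X ^ (Q ± 1)` and `A` has no root in `μ_{q+1}`, then `A` and `B`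
span one of the two standard pencils. -/
lemma exists_pencil_of_isLinearMonomialLinear (hq : q = p ^ k) (hQ : Q = p ^ l) (hQ2 : 2 ≤ Q)
    {a b c d : L} (ha : (a ^ q) ^ q = a) (hb : (b ^ q) ^ q = b) (hc : (c ^ q) ^ q = c)
    (hd : (d ^ q) ^ q = d) (habcd : ¬ (a = 0 ∧ b = 0 ∧ c = 0 ∧ d = 0))
    (h : IsLinearMonomialLinear Q (algebraMap L[X] (RatFunc L) (polyB q Q a b c d) /
      algebraMap L[X] (RatFunc L) (polyA Q a b c d)))
    (hμ : ¬ ∃ x : L, x ^ (q + 1) = 1 ∧ (polyA Q a b c d).eval x = 0) :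
    ∃ v₀ v₁ w₀ w₁ α₁ α₂ γ₁ γ₂ : L,
      IsPowerPencil Q (polyA Q a b c d) (polyB q Q a b c d) v₀ v₁ w₀ w₁ α₁ α₂ γ₁ γ₂ ∨
      IsTwistedPencil Q (polyA Q a b c d) (polyB q Q a b c d) v₀ v₁ w₀ w₁ α₁ α₂ γ₁ γ₂ := by
  have hQ0 : Q ≠ 0 := by omega
  have hA0 := polyA_ne_zero hQ2 habcd
  obtain ⟨n, v₀, v₁, w₀, w₁, α₁, α₂, γ₁, γ₂, hn, hvw, hΔ, hg⟩ :=
    exists_eq_powerRat_of_isLinearMonomialLinear h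
  have hn0 : n ≠ 0 := by omega
  by_cases hcz : ∀ α, ¬ (VanishAt (Q + 1) (polyA Q a b c d) α ∧
      VanishAt (Q + 1) (polyB q Q a b c d) α)
  · obtain ⟨hcop, hdeg⟩ := isCoprime_of_no_common_zero hcz
    have hdegn := ratDeg_eq hcop hA0
    change ratDeg (algebraMap L[X] (RatFunc L) (polyB q Q a b c d) / _) = _ at hdegn
    rw [hdeg, hg, ratDeg_powerRat hvw hn0 hΔ] at hdegn
    -- Without cancellation the degree is Q + 1, which excludes n = Q − 1; two reduced expressions
    -- of g then agree up to a scalar.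
    subst hdegn
    obtain ⟨κ, hκ, hB, hA⟩ := exists_num_denom_eq hcop hA0
    obtain ⟨ν, hν, hN, hD⟩ := exists_num_denom_eq (isCoprime_power_pencil (n := Q + 1) hvw hΔ)
      (power_pencil_ne_zero hvw hn0 (not_both_zero_left hΔ))
    rw [powerRat] at hg
    change RatFunc.num (algebraMap L[X] (RatFunc L) (polyB q Q a b c d) / _) =
      C κ * polyB q Q a b c d at hB
    change RatFunc.denom (algebraMap L[X] (RatFunc L) (polyB q Q a b c d) / _) = _ at hA
    rw [hg, hN] at hB
    rw [hg, hD] at hA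
    have hκi : C κ⁻¹ * C κ = (1 : L[X]) := by rw [← C_mul, inv_mul_cancel₀ hκ, C_1]
    refine ⟨v₀, v₁, w₀, w₁, κ⁻¹ * ν * α₁, κ⁻¹ * ν * α₂, κ⁻¹ * ν * γ₁, κ⁻¹ * ν * γ₂,
      Or.inl ⟨hvw, ?_, ?_, ?_⟩⟩
    · rw [show κ⁻¹ * ν * α₁ * (κ⁻¹ * ν * γ₂) - κ⁻¹ * ν * α₂ * (κ⁻¹ * ν * γ₁) =
        (κ⁻¹ * ν) ^ 2 * (α₁ * γ₂ - α₂ * γ₁) by ring]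
      exact mul_ne_zero (pow_ne_zero _ (mul_ne_zero (inv_ne_zero hκ) hν)) hΔ
    · simp only [C_mul]
      linear_combination -C κ⁻¹ * hA - polyA Q a b c d * hκi
    · simp only [C_mul]
      linear_combination -C κ⁻¹ * hB - polyB q Q a b c d * hκi
  · push Not at hcz
    obtain ⟨α, hA, hB⟩ := hcz
    obtain ⟨x₀, x₁, y₀, y₁, ρ₁, ρ₂, σ₁, σ₂, hxy, h1, h2⟩ :=
      exists_combination_of_common_zero hq hQ hQ2 ha hb hc hd hμ hA hB
    refine ⟨x₀, x₁, y₀, y₁, ρ₁, ρ₂, σ₁, σ₂, Or.inr ⟨hxy, fun hΔ' => ?_, h1, h2⟩⟩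
    -- Dependent combinations would make g constant, whereas its degree is n ≥ Q − 1 ≥ 1.
    obtain ⟨z, hz⟩ := exists_ratio_eq_C hA0 h1 h2 hΔ'
    have h3 := ratDeg_powerRat hvw hn0 hΔ
    rw [← hg, hz, ratDeg] at h3
    simp at h3
    exact hn0 h3.symm

end Geometry

/-! ### The field with q² elements -/

section FiniteFields

lemma charP_of_card_eq {p k q : ℕ} (hp : p.Prime) (hq : q = p ^ k) {K : Type*}
    [Field K] (hK : Nat.card K = q ^ 2) : Finite K ∧ CharP K p := by
  have hpos : 0 < Nat.card K := by rw [hK, hq]; exact pow_pos (pow_pos hp.pos k) 2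
  have hfin : Finite K := (Nat.card_pos_iff.1 hpos).2
  refine ⟨hfin, ?_⟩
  cases nonempty_fintype K
  obtain ⟨r, hr⟩ := CharP.exists K
  obtain ⟨n, hrp, hcard⟩ := FiniteField.card K r
  rw [Nat.card_eq_fintype_card, hcard, hq, ← pow_mul] at hK
  have hdvd : r ∣ p := hrp.dvd_of_dvd_pow (hK ▸ dvd_pow_self r n.ne_zero)
  rwa [(Nat.prime_dvd_prime_iff_eq hrp hp).1 hdvd] at hr

lemma pow_pow_eq_self {q : ℕ} {K : Type*} [Field K] [Finite K] (hK : Nat.card K = q ^ 2) (x : K) :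
    (x ^ q) ^ q = x := by
  cases nonempty_fintype K
  rw [← pow_mul, ← pow_two, ← hK, Nat.card_eq_fintype_card, FiniteField.pow_card]

end FiniteFields

/-! ### The coefficient criterion over the field with q² elements -/

section Criterion

variable {K : Type*} [Field K] {L : Type*} [Field L] [Algebra K L] {k l q Q : ℕ} {a b c d : K}

/-- `A` and `B` span one of the two standard pencils over `L`. -/
def IsStandardPencil (L : Type*) [Field L] [Algebra K L] (q Q : ℕ) (a b c d : K)
    (v₀ v₁ w₀ w₁ α₁ α₂ γ₁ γ₂ : L) : Prop :=
  IsPowerPencil Q ((polyA Q a b c d).map (algebraMap K L))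
      ((polyB q Q a b c d).map (algebraMap K L)) v₀ v₁ w₀ w₁ α₁ α₂ γ₁ γ₂ ∨
    IsTwistedPencil Q ((polyA Q a b c d).map (algebraMap K L))
      ((polyB q Q a b c d).map (algebraMap K L)) v₀ v₁ w₀ w₁ α₁ α₂ γ₁ γ₂

variable {v₀ v₁ w₀ w₁ α₁ α₂ γ₁ γ₂ : L}

lemma hasRootInMu_iff {n : ℕ} {P : K[X]} :
    HasRootInMu L n P ↔ ∃ x : L, x ^ n = 1 ∧ (P.map (algebraMap K L)).eval x = 0 := by
  simp [HasRootInMu, aeval_def, eval_map]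

/-- e is a sum of norms to the field with q elements. -/
lemma elemE_pow (hq : q = 2 ^ k) [CharP K 2] (hfix : ∀ x : K, (x ^ q) ^ q = x) :
    elemE q a b c d ^ q = elemE q a b c d := by
  have key : ∀ x : K, (x ^ (q + 1)) ^ q = x ^ (q + 1) := by
    intro x
    rw [pow_succ, mul_pow, hfix, mul_comm]
  have : Fact (Nat.Prime 2) := ⟨Nat.prime_two⟩
  have hadd : ∀ x y : K, (x + y) ^ q = x ^ q + y ^ q := by
    intro x y; rw [hq, add_pow_char_pow]
  rw [elemE, hadd, hadd, hadd, key, key, key, key]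

/-- With (a', b', c', d') = (d^q, c^q, b^q, a^q) the covariants of the pencil become U and e, and
the determinant form becomes W. -/
lemma IsStandardPencil.covariants [CharP K 2] [CharP L 2] (hq : q = 2 ^ k) (hQ : Q = 2 ^ l)
    (hQ2 : 2 ≤ Q) (hfix : ∀ x : K, (x ^ q) ^ q = x)
    (h : IsStandardPencil L q Q a b c d v₀ v₁ w₀ w₁ α₁ α₂ γ₁ γ₂) :
    elemE q a b c d ≠ 0 ∧
    (a * b ^ q + c * d ^ q) ^ Q = elemE q a b c d ^ (Q - 1) * (a * c ^ q + b * d ^ q) ∧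
    (∃ κ : L, κ ≠ 0 ∧
      (polyU q a b c d).map (algebraMap K L) = C κ * (lin v₀ v₁ * lin w₀ w₁)) ∧
    (v₀ * w₀ = 0 → v₁ * w₁ = 0) ∧
    ∀ s t : L, ¬ (s = 0 ∧ t = 0) → (proj s t ∈ setLambda L q a b c d ↔
      (t * γ₁ - s * α₁) * (t * γ₂ - s * α₂) = 0) := by
  have hQ0 : Q ≠ 0 := by omega
  have hq0 : q ≠ 0 := hq ▸ (pow_pos two_pos k).ne'
  have : Fact (Nat.Prime 2) := ⟨Nat.prime_two⟩
  have hadd : ∀ x y : K, (x + y) ^ q = x ^ q + y ^ q := by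
    intro x y; rw [hq, add_pow_char_pow]
  have hinj := (algebraMap K L).injective
  rw [IsStandardPencil, map_polyA, map_polyB] at h
  obtain ⟨Δ, F, hΔ, hF, hFdef, e1, e2, e3, e4, e5⟩ := standard_pencil_covariants hQ hQ2 h
  have hE : algebraMap K L (elemE q a b c d) = Δ * F ^ Q * F := by
    rw [← hFdef] at e2
    rw [← e2, map_elemE, elemE]
    ring
  rw [← map_pow, ← map_pow, ← map_mul, ← map_mul, ← map_add] at e1 e3
  have hκ : Δ * F ^ Q ≠ 0 := mul_ne_zero hΔ (pow_ne_zero _ hF)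
  have hE0 : elemE q a b c d ≠ 0 := by
    intro h0
    rw [h0, map_zero] at hE
    exact mul_ne_zero hκ hF hE.symm
  refine ⟨hE0, ?_, ⟨Δ * F ^ Q, hκ, ?_⟩, ?_, ?_⟩
  · apply hinj
    rw [map_pow, e1, map_mul, map_pow, map_add, map_mul, map_mul, map_pow, map_pow, e4]
    have h1 : algebraMap K L (elemE q a b c d) ^ (Q - 1) * algebraMap K L (elemE q a b c d) =
        (Δ * F ^ Q * F) ^ Q := by
      rw [← pow_succ, hE]; congr 1; omega
    apply mul_right_cancel₀ (pow_ne_zero Q hF)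
    rw [hE] at h1 ⊢
    rw [mul_pow _ (v₀ * w₀)]
    rw [mul_pow _ F Q] at h1
    linear_combination -(v₀ * w₀) ^ Q * h1
  · have e3' : algebraMap K L (a ^ q * b + c ^ q * d) = Δ * F ^ Q * (v₁ * w₁) := by
      rw [← e3]; congr 1; ring
    simp only [polyU, Polynomial.map_add, Polynomial.map_mul, map_C, Polynomial.map_pow, map_X]
    rw [e1, hE, e3', lin, lin]
    have hFC : (C F : L[X]) = C v₀ * C w₁ + C v₁ * C w₀ := by
      rw [hFdef, C_add, C_mul, C_mul]
    simp only [C_mul]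
    linear_combination C Δ * C (F ^ Q) * X * hFC
  -- The leading and constant coefficients of U are q-conjugate, so they vanish together.
  · intro h0
    rw [h0, mul_zero, map_eq_zero] at e1
    have h1 : b * a ^ q + d * c ^ q = 0 := by
      have := congrArg (· ^ q) e1
      simp only [hadd, mul_pow, hfix, zero_pow hq0] at this
      linear_combination this
    rw [h1, map_zero] at e3
    exact (mul_eq_zero.1 e3.symm).resolve_left hκ
  · intro s t hst
    rw [proj_mem_setLambda_iff hst]
    have hW : algebraMap K L (b * c + a * d) * s ^ 2 + algebraMap K L (elemE q a b c d) * s * t +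
        algebraMap K L ((b * c + a * d) ^ q) * t ^ 2 =
        F ^ Q * F * ((t * γ₁ - s * α₁) * (t * γ₂ - s * α₂)) := by
      rw [← e5, hE, e2, ← hFdef, hadd, mul_pow, mul_pow]
      simp only [map_add, map_mul, map_pow]
      ring
    rw [hW, mul_eq_zero, or_iff_right (mul_ne_zero (pow_ne_zero _ hF) hF)]

lemma exists_isStandardPencil_of_criterion [CharP K 2] [CharP L 2] [IsAlgClosed L]
    (hq : q = 2 ^ k) (hQ : Q = 2 ^ l) (hQ2 : 2 ≤ Q) (hfix : ∀ x : K, (x ^ q) ^ q = x)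
    (he : elemE q a b c d ≠ 0)
    (h : (a * b ^ q + c * d ^ q) ^ Q = elemE q a b c d ^ (Q - 1) * (a * c ^ q + b * d ^ q)) :
    ∃ v₀ v₁ w₀ w₁ α₁ α₂ γ₁ γ₂ : L, IsStandardPencil L q Q a b c d v₀ v₁ w₀ w₁ α₁ α₂ γ₁ γ₂ := by
  have : Fact (Nat.Prime 2) := ⟨Nat.prime_two⟩
  have hadd : ∀ x y : K, (x + y) ^ q = x ^ q + y ^ q := by
    intro x y; rw [hq, add_pow_char_pow]
  -- Raising the criterion to the q-th power fixes e and exchanges the end coefficients of U, so the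
  -- condition on constant coefficients comes for free.
  have h0 : (b * a ^ q + d * c ^ q) ^ Q =
      elemE q a b c d ^ (Q - 1) * (c * a ^ q + d * b ^ q) := by
    have h1 := congrArg (· ^ q) h
    simp only [mul_pow] at h1
    rw [← pow_mul, mul_comm Q q, pow_mul, ← pow_mul _ (Q - 1) q, mul_comm (Q - 1) q, pow_mul,
      elemE_pow hq hfix, hadd, hadd, mul_pow, mul_pow, mul_pow, mul_pow, hfix, hfix, hfix] at h1
    rw [show b * a ^ q + d * c ^ q = a ^ q * b + c ^ q * d by ring, h1]
    ring
  simp only [IsStandardPencil, map_polyA, map_polyB]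
  refine exists_pencil_of_criterion (e := algebraMap K L (elemE q a b c d)) hQ hQ2 ?_
    (by simpa using he) ?_ ?_
  · rw [map_elemE, elemE]; ring
  · have := congrArg (algebraMap K L) h
    simpa only [map_pow, map_mul, map_add] using this
  · have := congrArg (algebraMap K L) h0
    simpa only [map_pow, map_mul, map_add] using this

/-- The common factor of `A` and `B`, which is the constant `1` or proportional to `U`. -/
lemma IsStandardPencil.exists_isNormalForm (hQ : Q ≠ 0)
    (h : IsStandardPencil L q Q a b c d v₀ v₁ w₀ w₁ α₁ α₂ γ₁ γ₂) :
    ∃ (n : ℕ) (G : L[X]), IsNormalForm n G ((polyA Q a b c d).map (algebraMap K L))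
      ((polyB q Q a b c d).map (algebraMap K L)) v₀ v₁ w₀ w₁ α₁ α₂ γ₁ γ₂ ∧
      ((n = Q + 1 ∧ G = 1 ∧ IsPowerPencil Q ((polyA Q a b c d).map (algebraMap K L))
        ((polyB q Q a b c d).map (algebraMap K L)) v₀ v₁ w₀ w₁ α₁ α₂ γ₁ γ₂) ∨
      (n = Q - 1 ∧ G = lin v₀ v₁ * lin w₀ w₁)) := by
  rcases h with h | h
  · exact ⟨_, _, h.isNormalForm, Or.inl ⟨rfl, rfl, h⟩⟩
  · exact ⟨_, _, h.isNormalForm hQ, Or.inr ⟨rfl, rfl⟩⟩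

end Criterion

end QuadGeom

/-! ### Assembly of (A), (B) and (C) -/

theorem theorem3p1 {p k l q Q : ℕ} (hp : p.Prime) (hk : 0 < k) (hl : 0 < l)
    (hq : q = p ^ k) (hQ : Q = p ^ l)
    {K : Type*} [Field K] [DecidableEq K] (hK : Nat.card K = q ^ 2)
    (L : Type*) [Field L] [Algebra K L] [IsAlgClosure K L]
    (a b c d : K) (habcd : ¬ (a = 0 ∧ b = 0 ∧ c = 0 ∧ d = 0)) :
    -- (A)
    ((∃ β : OnePoint L, QuadGeom.ramMultiset (QuadGeom.ratG L q Q a b c d) β = {1, Q}) ∨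
      QuadGeom.IsLinearMonomialLinear Q (QuadGeom.ratG L q Q a b c d) ∨
      (∃ z : L, QuadGeom.ratG L q Q a b c d = RatFunc.C z) ∨
      QuadGeom.HasRootInMu L (q + 1) (QuadGeom.polyA Q a b c d)) ∧
    -- (B)
    (Even q →
      ((QuadGeom.IsLinearMonomialLinear Q (QuadGeom.ratG L q Q a b c d) ∧
          ¬ QuadGeom.HasRootInMu L (q + 1) (QuadGeom.polyA Q a b c d)) ↔
        QuadGeom.CoeffCriterion L q Q a b c d)) ∧
    -- (C)
    (Even q → QuadGeom.CoeffCriterion L q Q a b c d →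
      (∀ β ∈ QuadGeom.setLambda L q a b c d,
        ∃! α : OnePoint L, QuadGeom.evalP1 (QuadGeom.ratG L q Q a b c d) α = β) ∧
      (∀ x : L, aeval x (QuadGeom.polyU q a b c d) = 0 →
        ∃ β ∈ QuadGeom.setLambda L q a b c d, ∀ α : OnePoint L,
          QuadGeom.evalP1 (QuadGeom.ratG L q Q a b c d) α = β ↔ α = OnePoint.some x) ∧
      EuclideanDomain.gcd (QuadGeom.polyA Q a b c d) (QuadGeom.polyB q Q a b c d) ∣
        QuadGeom.polyU q a b c d ∧
      (QuadGeom.ratDeg (QuadGeom.ratG L q Q a b c d) = Q - 1 ↔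
        QuadGeom.polyU q a b c d ∣ QuadGeom.polyA Q a b c d ∧
          ¬ (b = 0 ∧ c = 0 ∧ d = 0))) := by
  have : Fact p.Prime := ⟨hp⟩
  obtain ⟨hfin, hcharK⟩ := QuadGeom.charP_of_card_eq hp hq hK
  have hcharL : CharP L p := charP_of_injective_algebraMap (algebraMap K L).injective p
  have : IsAlgClosed L := IsAlgClosure.isAlgClosed K
  have hQ2 : 2 ≤ Q := hQ ▸ hp.two_le.trans (Nat.le_self_pow hl.ne' p)
  have hQ0 : Q ≠ 0 := by omega
  have hfix := QuadGeom.pow_pow_eq_self hK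
  have hfixL : ∀ x : K, (algebraMap K L x ^ q) ^ q = algebraMap K L x := by
    intro x; rw [← map_pow, ← map_pow, hfix]
  have habcdL : ¬ (algebraMap K L a = 0 ∧ algebraMap K L b = 0 ∧ algebraMap K L c = 0 ∧
      algebraMap K L d = 0) := by simpa using habcd
  have hg : QuadGeom.ratG L q Q a b c d =
      algebraMap L[X] (RatFunc L) ((QuadGeom.polyB q Q a b c d).map (algebraMap K L)) /
        algebraMap L[X] (RatFunc L) ((QuadGeom.polyA Q a b c d).map (algebraMap K L)) := rfl
  have hp2 : Even q → p = 2 := by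
    intro h
    rw [hq, Nat.even_pow] at h
    exact hp.even_iff.1 h.1
  refine ⟨?_, ?_, ?_⟩
  · rw [QuadGeom.hasRootInMu_iff]
    rw [QuadGeom.map_polyA, QuadGeom.map_polyB] at hg
    rw [QuadGeom.map_polyA]
    exact QuadGeom.ramification_cases hq hQ hQ2 (hfixL a) (hfixL b) (hfixL c) (hfixL d) habcdL hg
  · intro hqe
    obtain rfl := hp2 hqe
    constructor
    · rintro ⟨hlml, hμ⟩
      have hμ' := hμ
      rw [QuadGeom.hasRootInMu_iff, QuadGeom.map_polyA] at hμ'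
      rw [hg, QuadGeom.map_polyA, QuadGeom.map_polyB] at hlml
      obtain ⟨v₀, v₁, w₀, w₁, α₁, α₂, γ₁, γ₂, hpen⟩ :=
        QuadGeom.exists_pencil_of_isLinearMonomialLinear hq hQ hQ2 (hfixL a) (hfixL b) (hfixL c)
          (hfixL d) habcdL hlml hμ'
      rw [← QuadGeom.map_polyA, ← QuadGeom.map_polyB] at hpen
      obtain ⟨he, hcrit, -⟩ := QuadGeom.IsStandardPencil.covariants hq hQ hQ2 hfix hpen
      refine ⟨he, hcrit, ?_⟩
      by_contra! hU
      obtain ⟨hdvd, x, hx, hUx⟩ := hU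
      exact hμ ⟨x, hx, aeval_eq_zero_of_dvd_aeval_eq_zero hdvd hUx⟩
    · rintro ⟨he, hcrit, hU⟩
      obtain ⟨v₀, v₁, w₀, w₁, α₁, α₂, γ₁, γ₂, hpen⟩ :=
        QuadGeom.exists_isStandardPencil_of_criterion (L := L) hq hQ hQ2 hfix he hcrit
      refine ⟨hg ▸ QuadGeom.isLinearMonomialLinear_of_pencil hQ0 hpen, ?_⟩
      rw [QuadGeom.hasRootInMu_iff]
      rintro ⟨x, hx, hAx⟩
      -- A root of A in μ_{q+1} is a root of B, hence of the common factor G. So G is proportional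
      -- to U, and both alternatives of the third clause fail.
      have hBx : ((QuadGeom.polyB q Q a b c d).map (algebraMap K L)).eval x = 0 := by
        rw [QuadGeom.map_polyB]
        rw [QuadGeom.map_polyA] at hAx
        exact QuadGeom.eval_polyB_eq_zero hq hx hAx
      obtain ⟨-, -, ⟨κ, hκ, hUG⟩, -⟩ := QuadGeom.IsStandardPencil.covariants hq hQ hQ2 hfix hpen
      obtain ⟨n, G, hnf, ⟨-, rfl, -⟩ | ⟨-, rfl⟩⟩ := hpen.exists_isNormalForm hQ0
      · simpa using hnf.eval_eq_zero hAx hBx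
      · have hGx := hnf.eval_eq_zero hAx hBx
        rcases hU with hU | hU
        · refine hU ((map_dvd_map' (algebraMap K L)).1 ?_)
          rw [hUG, (isUnit_C.2 hκ.isUnit).mul_left_dvd, hnf.left]
          exact dvd_mul_right _ _
        · refine hU (QuadGeom.hasRootInMu_iff.2 ⟨x, hx, ?_⟩)
          rw [hUG, eval_mul, hGx, mul_zero]
  · intro hqe hcriterion
    obtain rfl := hp2 hqe
    obtain ⟨v₀, v₁, w₀, w₁, α₁, α₂, γ₁, γ₂, hpen⟩ :=
      QuadGeom.exists_isStandardPencil_of_criterion (L := L) hq hQ hQ2 hfix hcriterion.1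
        hcriterion.2.1
    obtain ⟨-, -, ⟨κ, hκ, hUG⟩, h01, hΛ⟩ :=
      QuadGeom.IsStandardPencil.covariants hq hQ hQ2 hfix hpen
    obtain ⟨n, G, hnf, hnG⟩ := hpen.exists_isNormalForm hQ0
    have hvw := hnf.forms
    have hΔ := hnf.coeffs
    have hwv : w₀ * v₁ - w₁ * v₀ ≠ 0 := fun h => hvw (by linear_combination -h)
    have hΔ' : α₂ * γ₁ - α₁ * γ₂ ≠ 0 := fun h => hΔ (by linear_combination -h)
    have hn0 : n ≠ 0 := by omega
    have hv := QuadGeom.lin_ne_zero (QuadGeom.not_both_zero_left hvw)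
    have hw := QuadGeom.lin_ne_zero (QuadGeom.not_both_zero_right hvw)
    have hG0 : G ≠ 0 := by
      rcases hnG with ⟨-, rfl, -⟩ | ⟨-, rfl⟩
      · exact one_ne_zero
      · exact mul_ne_zero hv hw
    have hGdvd : G ∣ QuadGeom.lin v₀ v₁ * QuadGeom.lin w₀ w₁ := by
      rcases hnG with ⟨-, rfl, -⟩ | ⟨-, rfl⟩
      · exact one_dvd _
      · exact dvd_rfl
    have hκu : IsUnit (C κ : L[X]) := isUnit_C.2 hκ.isUnit
    rw [hg, hnf.ratio_eq hG0]
    refine ⟨?_, ?_, ?_, ?_⟩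
    · intro β hβ
      obtain ⟨s, t, hst, rfl⟩ := QuadGeom.exists_eq_proj β
      rcases mul_eq_zero.1 ((hΛ s t hst).1 hβ) with h | h
      · have key := QuadGeom.evalP1_powerRat_eq_iff_left (n := n) hwv hn0 hΔ' hst h
        simp_rw [QuadGeom.powerRat_swap n w₀] at key
        exact ⟨_, (key _).2 rfl, fun α hα => (key α).1 hα⟩
      · have key := QuadGeom.evalP1_powerRat_eq_iff_left (n := n) hvw hn0 hΔ hst h
        exact ⟨_, (key _).2 rfl, fun α hα => (key α).1 hα⟩
    · intro x hx
      rw [aeval_def, ← eval_map, hUG, eval_mul, eval_C, eval_mul, mul_eq_zero, or_iff_right hκ,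
        mul_eq_zero] at hx
      rcases hx with hx | hx
      · refine ⟨QuadGeom.proj γ₂ α₂, (hΛ _ _ ?_).2 (by ring), fun α =>
          QuadGeom.evalP1_powerRat_eq_iff_of_eval_lin_eq_zero hn0 hvw hΔ hx α⟩
        rintro ⟨h1, h2⟩
        exact hΔ (by rw [h1, h2]; ring)
      · refine ⟨QuadGeom.proj γ₁ α₁, (hΛ _ _ ?_).2 (by ring), fun α => ?_⟩
        · rintro ⟨h1, h2⟩
          exact hΔ (by rw [h1, h2]; ring)
        · rw [QuadGeom.powerRat_swap]
          exact QuadGeom.evalP1_powerRat_eq_iff_of_eval_lin_eq_zero hn0 hwv hΔ' hx α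
    · refine (map_dvd_map' (algebraMap K L)).1 ?_
      rw [hUG]
      refine ((hnf.dvd_of_dvd ?_ ?_).trans hGdvd).mul_left _
      · exact (map_dvd_map' _).2 (EuclideanDomain.gcd_dvd_left _ _)
      · exact (map_dvd_map' _).2 (EuclideanDomain.gcd_dvd_right _ _)
    · rw [QuadGeom.ratDeg_powerRat hvw hn0 hΔ]
      constructor
      · intro hnQ
        obtain ⟨hn, -⟩ | ⟨-, rfl⟩ := hnG
        · omega
        constructor
        · refine (map_dvd_map' (algebraMap K L)).1 ?_
          rw [hUG, hκu.mul_left_dvd, hnf.left]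
          exact dvd_mul_right _ _
        -- Now B is a nonzero constant divisible by l₁ l₂, so both linear forms would vanish only at
        -- ∞.
        · rintro ⟨rfl, rfl, rfl⟩
          have ha : a ≠ 0 := by simpa using habcd
          have hq0 : q ≠ 0 := hq ▸ (pow_pos two_pos k).ne'
          have hunit : IsUnit ((QuadGeom.polyB q Q a 0 0 0).map (algebraMap K L)) := by
            have : QuadGeom.polyB q Q a 0 0 0 = C (a ^ q) := by simp [QuadGeom.polyB, hq0]
            rw [this, map_C, isUnit_C]
            exact (by simp [ha, hq0] : algebraMap K L (a ^ q) ≠ 0).isUnit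
          rw [hnf.right, IsUnit.mul_iff, IsUnit.mul_iff] at hunit
          have h1 := QuadGeom.coeff_eq_zero_of_isUnit_lin hunit.1.1
          have h2 := QuadGeom.coeff_eq_zero_of_isUnit_lin hunit.1.2
          exact hvw (by rw [h1, h2]; ring)
      · rintro ⟨hdvd, hbcd⟩
        have hdvdL := (map_dvd_map' (algebraMap K L)).2 hdvd
        rw [hUG, hκu.mul_left_dvd] at hdvdL
        obtain ⟨-, rfl, h⟩ | ⟨hn, -⟩ := hnG
        swap
        · exact hn
        exfalso
        -- If U divides A in a power pencil, then A is a multiple of X^{Q+1}; this is the exception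
        -- b = c = d = 0.
        obtain ⟨r, hr⟩ : ∃ r, (QuadGeom.polyA Q a b c d).map (algebraMap K L) =
            C r * X ^ (Q + 1) := by
          by_cases hα₂ : α₂ = 0
          · have hα₁ : α₁ ≠ 0 := by rintro rfl; exact hΔ (by rw [hα₂]; ring)
            exact h.swap.eq_C_mul_X_pow_of_dvd (by rwa [mul_comm])
              (by rwa [mul_comm w₀, mul_comm w₁]) hα₁
          · exact h.eq_C_mul_X_pow_of_dvd hdvdL h01 hα₂
        rw [QuadGeom.map_polyA, show C r * X ^ (Q + 1) = QuadGeom.polyA Q r 0 0 0 by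
          simp [QuadGeom.polyA]] at hr
        obtain ⟨-, hb, hc, hd⟩ := QuadGeom.polyA_inj hQ2 hr
        exact hbcd (by simpa using And.intro hb (And.intro hc hd))
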